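/- Graphs are finite and connected; self-edges and parallel edges are allowed. The degree $\deg(v)$ of a vertex $v$ is the number of edges incident to $v$ (a self-edge counts once). Simple random walk moves at each step along an edge chosen uniformly among the edges incident to its current position. A sequence of graphs $G_n$ with $|V(G_n)|\to\infty$ is called Gino-regular if there is a sequence of real numbers $D_n$ such that, as $n\to\infty$, (i) the maximum and the minimum degree of a vertex of $G_n$ are $(1+o(1))D_n$; and (ii) the maximum and the minimum, over distinct vertices $x,y,z$ of $G_n$, of the probability that simple random walk on $G_n$ started at $x$ hits $y$ before $z$ are $1/2+o(1)$. For a finite tree $t$ rooted at $x$ and a tree $W$ rooted at $v$, let $N(W;t)$ be the number of tree-maps from $t$ into $W$, that is, of injective maps from the vertices of $t$ to the vertices of $W$ that map $x$ to $v$ and neighbors to neighbors. Let $|t|$ be the number of vertices of $t$. Let $(G_n)$ be a Gino-regular sequence of graphs, let $v_n$ be a vertex of $G_n$, and let $\mathbf T_n$ be a spanning tree of $G_n$ chosen uniformly at random among all spanning trees of $G_n$, rooted at $v_n$. Then for every finite rooted tree $t$, $$\mathbf E\, N(\mathbf T_n;t)\longrightarrow |t|\qquad\text{as } n\to\infty .$$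 -/

import Mathlib

open Filter Topology

/-- A graph with vertex set `V` and edge set `E`; self-edges and parallel edges are allowed.
`ends e` is the unordered pair of (possibly equal) end vertices of the edge `e`. -/
structure MGraph (V E : Type*) where
  ends : E → Sym2 V

namespace MGraph

noncomputable section

variable {V E : Type*}

/-- The neighbour relation of the subgraph of `G` with vertex set `V` and edge set `S`:
distinct vertices `a`, `b` are adjacent iff some edge in `S` connects them. -/
def nbrGraph (G : MGraph V E) (S : Set E) : SimpleGraph V :=
  SimpleGraph.fromEdgeSet (G.ends '' S)

/-- Any two vertices are joined by a path of edges (and there is a vertex). -/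
def Connected (G : MGraph V E) : Prop :=
  (G.nbrGraph Set.univ).Connected

/-- The subgraph with edge set `S` is connected and has no cycles: no cycle of length one
(self-edge), none of length two (pair of parallel edges), and no longer one. -/
def IsSpanningTree (G : MGraph V E) (S : Finset E) : Prop :=
  (∀ e ∈ S, ¬ (G.ends e).IsDiag) ∧ Set.InjOn G.ends (S : Set E) ∧
    (G.nbrGraph (S : Set E)).IsTree

open Classical in
/-- The finite set of all spanning trees of `G`. -/
def spanningTrees [Fintype E] (G : MGraph V E) : Finset (Finset E) :=
  {S | G.IsSpanningTree S}

open Classical in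
/-- The probability that a uniform spanning tree of `G` equals `S`. -/
def ustProb [Fintype E] (G : MGraph V E) (S : Finset E) : ℝ :=
  if S ∈ G.spanningTrees then 1 / (G.spanningTrees.card : ℝ) else 0

/-- The expectation of `X T`, for `T` a uniform spanning tree of `G`. -/
def ustExpectation [Fintype E] (G : MGraph V E) (X : Finset E → ℝ) : ℝ :=
  ∑ S : Finset E, G.ustProb S * X S

open Classical in
/-- The number of edges incident to `v` (a self-edge counts once). -/
def degree [Fintype E] (G : MGraph V E) (v : V) : ℕ :=
  Finset.card {e : E | v ∈ G.ends e}

open Classical in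
/-- One-step transition probability of simple random walk from `x` to `y`: one of the edges
incident to `x` is chosen uniformly and the walk moves along it. -/
def stepProb [Fintype E] (G : MGraph V E) (x y : V) : ℝ :=
  (Finset.card {e : E | G.ends e = s(x, y)} : ℝ) / (G.degree x : ℝ)

/-- The probability that simple random walk started at `γ 0` has
`γ 0, γ 1, …, γ k` as its first `k + 1` positions. -/
def pathProb [Fintype E] (G : MGraph V E) {k : ℕ} (γ : Fin (k + 1) → V) : ℝ :=
  ∏ i : Fin k, G.stepProb (γ i.castSucc) (γ i.succ)

open Classical in
/-- For `y ≠ z`, the probability that simple random walk started at `x` visits `y` and does so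
before visiting `z`: the sum over all times `k` of the probability that the walk is
in `{y, z}` at time `k` for the first time, and is then at `y`. -/
def hitBeforeProb [Fintype V] [Fintype E] (G : MGraph V E) (x y z : V) : ℝ :=
  ∑' k : ℕ, ∑ γ : Fin (k + 1) → V with
    (γ 0 = x ∧ γ (Fin.last k) = y ∧ ∀ i : Fin k, γ i.castSucc ≠ y ∧ γ i.castSucc ≠ z),
    G.pathProb γ

/-- A sequence of graphs whose number of vertices tends to infinity is Gino-regular if, for some
sequence `D`, all degrees are `(1 + o(1)) D n` and all probabilities that the
walk from `x` hits `y` before `z`, for `x, y, z` distinct, are `1/2 + o(1)`, uniformly over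
the vertices. -/
def GinoRegular {V E : ℕ → Type*} [∀ n, Fintype (V n)] [∀ n, Fintype (E n)]
    (G : ∀ n, MGraph (V n) (E n)) : Prop :=
  Tendsto (fun n => Fintype.card (V n)) atTop atTop ∧
  ∃ D : ℕ → ℝ,
    (∀ ε > 0, ∀ᶠ n in atTop, ∀ v : V n, |((G n).degree v : ℝ) - D n| ≤ ε * D n) ∧
    (∀ ε > 0, ∀ᶠ n in atTop, ∀ x y z : V n, x ≠ y → x ≠ z → y ≠ z →
      |(G n).hitBeforeProb x y z - 1 / 2| ≤ ε)

end

end MGraph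

/-- `N(W; t)`: the number of injective maps from the vertices of `t` to the vertices of `W` that
send the root `x` to the root `v` and neighbours to neighbours. -/
noncomputable def treeMapCount {τ V : Type*} (t : SimpleGraph τ) (x : τ)
    (W : SimpleGraph V) (v : V) : ℕ :=
  Nat.card {f : τ → V // Function.Injective f ∧ f x = v ∧
    ∀ a b, t.Adj a b → W.Adj (f a) (f b)}

/-! Expand the expectation over injective maps `f` with `f x = v`. A spanning tree contains `f(t)`
exactly when it arises from an edge over each edge of `t` together with a spanning forest rooted at
the image of `f`. So `f` contributes a product of edge multiplicities times the number of such
forests, divided by the number of spanning trees (`ustExpectation_treeMapCount`).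

By a matrix-tree theorem for rooted forests (`det_rootedLaplacian`), this quotient of counts is the
minor, on `f(τ \ {x})`, of the Green function killed at `v` (`Connected.forestCount_eq_det`). Its
entries factor as a hitting probability times a diagonal entry. With hitting probabilities near 1/2,
all diagonal entries are close to one number `r`, and off-diagonal ones to `r / 2`. With `k = |t| -
1`, the minor is then about `r ^ k * (k + 1) / 2 ^ k`.

The diagonal entry is also the inverse of an escape rate. Hence the weights `ω a b = edgeCount a b *
r / 2` out of any vertex sum to about 1 over the other vertices, and each is small
(`Connected.degree_near`). Avoiding collisions therefore costs little, and the products of `ω` along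
`t` sum to about 1 over injective maps (`sum_prod_injExtensions_near`). The factor `2 ^ k` left over
cancels the denominator of the minor, and `k + 1 = |t|` remains. -/

namespace MGraph

/-! ### Rooted spanning forests and contraction of an edge into the root set -/

section RootedForests

open Classical

variable {V E : Type*}

/-- Every vertex is joined to a vertex of `S` by edges in `B`. -/
def Covers (G : MGraph V E) (S : Finset V) (B : Finset E) : Prop :=
  ∀ z, ∃ s ∈ S, (G.nbrGraph (B : Set E)).Reachable z s

/-- `B` is the edge set of a spanning forest of which every component contains exactly one
vertex of `S`. -/
def IsRootedForest [Fintype V] (G : MGraph V E) (S : Finset V) (B : Finset E) : Prop :=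
  G.Covers S B ∧ B.card + S.card = Fintype.card V

theorem nbrGraph_adj {G : MGraph V E} {B : Set E} {a b : V} :
    (G.nbrGraph B).Adj a b ↔ (∃ e ∈ B, G.ends e = s(a, b)) ∧ a ≠ b := by
  simp [nbrGraph]

theorem nbrGraph_mono (G : MGraph V E) {A B : Set E} (h : A ⊆ B) :
    G.nbrGraph A ≤ G.nbrGraph B := by
  intro a b
  rw [nbrGraph_adj, nbrGraph_adj]
  rintro ⟨⟨e, he, h'⟩, hab⟩
  exact ⟨⟨e, h he, h'⟩, hab⟩

theorem Covers.exists_crossing [Fintype V] {G : MGraph V E} {S : Finset V} {B : Finset E}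
    (h : G.Covers S B) (hS : S ≠ Finset.univ) :
    ∃ e ∈ B, ∃ s ∈ S, ∃ y ∉ S, G.ends e = s(s, y) := by
  obtain ⟨z, hz⟩ : ∃ z, z ∉ S := by
    by_contra! hc
    exact hS (Finset.eq_univ_iff_forall.2 hc)
  obtain ⟨s, hs, ⟨p⟩⟩ := h z
  obtain ⟨d, -, h1, h2⟩ := p.exists_boundary_dart {a | a ∉ S} hz (by simpa using hs)
  obtain ⟨⟨e, he, hends⟩, -⟩ := nbrGraph_adj.1 d.adj
  exact ⟨e, he, d.snd, by simpa using h2, d.fst, h1, by rw [hends, Sym2.eq_swap]⟩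

/-- A walk to `S` that would use `e` can stop there: both ends of `e` belong to the enlarged root
set. -/
theorem Covers.insert_erase {G : MGraph V E} {S : Finset V} {B : Finset E}
    (h : G.Covers S B) {e : E} {s y : V} (he : G.ends e = s(s, y)) (hs : s ∈ S) :
    G.Covers (insert y S) (B.erase e) := by
  have key : ∀ z w, (G.nbrGraph (B : Set E)).Walk z w → w ∈ S →
      ∃ s' ∈ insert y S, (G.nbrGraph ((B.erase e : Finset E) : Set E)).Reachable z s' := by
    intro z w p hw
    induction p with
    | nil => exact ⟨_, Finset.mem_insert_of_mem hw, .refl _⟩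
    | @cons a b c hab p ih =>
      obtain ⟨s', hs', hr⟩ := ih hw
      obtain ⟨⟨e', he', hends⟩, hne⟩ := nbrGraph_adj.1 hab
      by_cases hee : e' = e
      · subst hee
        refine ⟨a, ?_, .refl _⟩
        have : a ∈ s(s, y) := by rw [← he, hends]; simp
        rcases Sym2.mem_iff.1 this with rfl | rfl
        · exact Finset.mem_insert_of_mem hs
        · simp
      · refine ⟨s', hs', SimpleGraph.Reachable.trans (SimpleGraph.Adj.reachable ?_) hr⟩
        exact nbrGraph_adj.2 ⟨⟨e', by simpa [hee] using he', hends⟩, hne⟩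
  intro z
  obtain ⟨w, hw, ⟨p⟩⟩ := h z
  exact key z w p hw

theorem Covers.of_insert {G : MGraph V E} {S : Finset V} {B : Finset E} {e : E} {s y : V}
    (h : G.Covers (insert y S) B) (he : G.ends e = s(s, y)) (hs : s ∈ S) :
    G.Covers S (insert e B) := by
  intro z
  obtain ⟨w, hw, hr⟩ := h z
  have hr' := hr.mono (G.nbrGraph_mono (B := ((insert e B : Finset E) : Set E)) (by simp))
  rcases Finset.mem_insert.1 hw with rfl | hw
  · by_cases hsw : w = s
    · exact ⟨w, hsw ▸ hs, hr'⟩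
    · refine ⟨s, hs, hr'.trans (SimpleGraph.Adj.reachable ?_)⟩
      exact nbrGraph_adj.2 ⟨⟨e, by simp, by rw [he, Sym2.eq_swap]⟩, hsw⟩
  · exact ⟨w, hw, hr'⟩

/-- Trading a crossing edge for a new root preserves `B.card + S.card`, and the trade can continue
until every vertex is a root. -/
theorem Covers.card_le [Fintype V] {G : MGraph V E} {S : Finset V} {B : Finset E}
    (h : G.Covers S B) : Fintype.card V ≤ B.card + S.card := by
  induction hn : B.card generalizing S B with
  | zero =>
    by_cases hS : S = Finset.univ
    · simp [hS]
    · obtain ⟨e, he, -⟩ := h.exists_crossing hS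
      simp [Finset.card_eq_zero.1 hn] at he
  | succ n ih =>
    by_cases hS : S = Finset.univ
    · simp [hS]
    · obtain ⟨e, he, s, hs, y, hy, hends⟩ := h.exists_crossing hS
      have := ih (h.insert_erase hends hs) (by rw [Finset.card_erase_of_mem he, hn]; rfl)
      rw [Finset.card_insert_of_notMem hy] at this
      omega

theorem edgeSet_nbrGraph_subset (G : MGraph V E) (B : Finset E) :
    (G.nbrGraph (B : Set E)).edgeSet ⊆ ((B.image G.ends : Finset (Sym2 V)) : Set (Sym2 V)) := by
  simp [nbrGraph, SimpleGraph.edgeSet_fromEdgeSet]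

variable [Fintype V]

/-- An edge between two roots could be deleted without losing coverage, which would contradict the
bound of `Covers.card_le`. -/
theorem IsRootedForest.not_inside {G : MGraph V E} {S : Finset V} {B : Finset E}
    (h : G.IsRootedForest S B) {e : E} (he : e ∈ B) {a b : V} (ha : a ∈ S) (hb : b ∈ S) :
    G.ends e ≠ s(a, b) := by
  intro hends
  have h1 := (h.1.insert_erase hends ha).card_le
  rw [Finset.insert_eq_of_mem hb, Finset.card_erase_of_mem he] at h1
  have := Finset.card_pos.2 ⟨e, he⟩
  have := h.2
  omega

/-- Contraction of `e`, expressed by making `y` a root. Both the count of trees through given edges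
and the matrix-tree recursion rest on it. -/
theorem isRootedForest_insert_iff {G : MGraph V E} {S : Finset V} {B : Finset E} {e : E}
    {s y : V} (he : G.ends e = s(s, y)) (hs : s ∈ S) (hy : y ∉ S) (heB : e ∉ B) :
    G.IsRootedForest S (insert e B) ↔ G.IsRootedForest (insert y S) B := by
  unfold IsRootedForest
  rw [Finset.card_insert_of_notMem hy, Finset.card_insert_of_notMem heB]
  constructor
  · rintro ⟨h, hc⟩
    refine ⟨?_, by omega⟩
    have := h.insert_erase he hs
    rwa [Finset.erase_insert heB] at this
  · rintro ⟨h, hc⟩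
    exact ⟨h.of_insert he hs, by omega⟩

theorem isRootedForest_univ {G : MGraph V E} {B : Finset E} :
    G.IsRootedForest Finset.univ B ↔ B = ∅ := by
  constructor
  · rintro ⟨-, h⟩
    simpa [Finset.card_univ] using h
  · rintro rfl
    exact ⟨fun z => ⟨z, by simp, .refl _⟩, by simp [Finset.card_univ]⟩

theorem Covers.exists_isRootedForest {G : MGraph V E} {S : Finset V} {A : Finset E}
    (h : G.Covers S A) : ∃ B, G.IsRootedForest S B := by
  suffices ∃ B ⊆ A, G.IsRootedForest S B from this.imp fun B hB => hB.2
  induction hn : A.card generalizing S A with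
  | zero =>
    by_cases hS : S = Finset.univ
    · exact ⟨∅, by simp, hS ▸ isRootedForest_univ.2 rfl⟩
    · obtain ⟨e, he, -⟩ := h.exists_crossing hS
      simp [Finset.card_eq_zero.1 hn] at he
  | succ n ih =>
    by_cases hS : S = Finset.univ
    · exact ⟨∅, by simp, hS ▸ isRootedForest_univ.2 rfl⟩
    · obtain ⟨e, he, s, hs, y, hy, hends⟩ := h.exists_crossing hS
      obtain ⟨B, hBA, hB⟩ :=
        ih (h.insert_erase hends hs) (by rw [Finset.card_erase_of_mem he, hn]; rfl)
      rw [Finset.subset_erase] at hBA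
      exact ⟨insert e B, Finset.insert_subset he hBA.1,
        (isRootedForest_insert_iff hends hs hy hBA.2).2 hB⟩

theorem isSpanningTree_iff_isRootedForest {G : MGraph V E} {B : Finset E} (v : V) :
    G.IsSpanningTree B ↔ G.IsRootedForest {v} B := by
  constructor
  · rintro ⟨h1, h2, h3⟩
    refine ⟨fun z => ⟨v, by simp, h3.connected z v⟩, ?_⟩
    have := h3.card_edgeFinset
    rw [Finset.card_singleton, ← this]
    congr 1
    rw [← Finset.card_image_of_injOn h2]
    congr 1
    ext q
    induction q with | _ a b =>
    simp only [Finset.mem_image, SimpleGraph.mem_edgeFinset, SimpleGraph.mem_edgeSet, nbrGraph_adj,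
      Finset.mem_coe]
    constructor
    · rintro ⟨e, he, hq⟩
      refine ⟨⟨e, he, hq⟩, ?_⟩
      rintro rfl
      exact h1 e he (by rw [hq]; simp)
    · exact fun h => h.1
  · rintro ⟨h, hc⟩
    have hconn : (G.nbrGraph (B : Set E)).Connected := by
      have : Nonempty V := ⟨v⟩
      refine ⟨fun a b => ?_⟩
      obtain ⟨s, hs, ha⟩ := h a
      obtain ⟨s', hs', hb⟩ := h b
      rw [Finset.mem_singleton] at hs hs'
      subst hs hs'
      exact ha.trans hb.symm
    -- The chain `|V| - 1 ≤` adjacent pairs `≤` image of `ends` `≤ B.card = |V| - 1` is tight. Its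
    -- equalities exclude self-edges, parallel edges and cycles.
    have hle := hconn.card_vert_le_card_edgeSet_add_one
    have hsub : (G.nbrGraph (B : Set E)).edgeFinset ⊆ B.image G.ends := by
      intro q hq
      exact G.edgeSet_nbrGraph_subset B (by simpa using hq)
    rw [Nat.card_eq_fintype_card, Nat.card_eq_fintype_card, ← SimpleGraph.edgeFinset_card] at hle
    have h1 := Finset.card_le_card hsub
    have h2 : (B.image G.ends).card ≤ B.card := Finset.card_image_le
    rw [Finset.card_singleton] at hc
    have heq : (G.nbrGraph (B : Set E)).edgeFinset = B.image G.ends :=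
      Finset.eq_of_subset_of_card_le hsub (by omega)
    refine ⟨?_, ?_, ?_⟩
    · intro e he hd
      have : G.ends e ∈ (G.nbrGraph (B : Set E)).edgeFinset := by
        rw [heq]; exact Finset.mem_image_of_mem _ he
      exact SimpleGraph.not_isDiag_of_mem_edgeFinset this hd
    · exact Finset.card_image_iff.1 (by omega)
    · rw [SimpleGraph.isTree_iff_connected_and_card]
      refine ⟨hconn, ?_⟩
      rw [Nat.card_eq_fintype_card, Nat.card_eq_fintype_card, ← SimpleGraph.edgeFinset_card]
      omega

/-- The number of edges in `A` with ends `x` and `y`. -/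
noncomputable def edgeCount (G : MGraph V E) (A : Finset E) (x y : V) : ℕ :=
  (A.filter fun e => G.ends e = s(x, y)).card

/-! ### Growing a tree edge by edge and counting forests through given pairs -/

/-- A list of pairs (old vertex, new vertex) by which a set of vertices is enlarged
step by step until it contains all vertices. -/
inductive Grows {τ : Type*} [Fintype τ] : Finset τ → List (τ × τ) → Prop
  | nil : Grows Finset.univ []
  | cons {U : Finset τ} {p y : τ} {L : List (τ × τ)} (hp : p ∈ U) (hy : y ∉ U)
      (h : Grows (insert y U) L) : Grows U ((p, y) :: L)

theorem Grows.length_add_card {τ : Type*} [Fintype τ] {U : Finset τ} {L : List (τ × τ)}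
    (h : Grows U L) : L.length + U.card = Fintype.card τ := by
  induction h with
  | nil => simp [Finset.card_univ]
  | cons hp hy h ih =>
    rw [Finset.card_insert_of_notMem hy] at ih
    simp only [List.length_cons]
    omega

theorem Grows.snd_notMem {τ : Type*} [Fintype τ] {U : Finset τ} {L : List (τ × τ)}
    (h : Grows U L) : ∀ q ∈ L, q.2 ∉ U := by
  induction h with
  | nil => simp
  | cons hp hy h ih =>
    intro q hq
    rcases List.mem_cons.1 hq with rfl | hq
    · exact hy
    · exact fun hU => ih q hq (Finset.mem_insert_of_mem hU)

theorem IsRootedForest.exists_grows {G : MGraph V E} {S : Finset V} {B : Finset E}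
    (h : G.IsRootedForest S B) :
    ∃ L, Grows S L ∧ ∀ q, (∃ e ∈ B, G.ends e = q) ↔ ∃ p ∈ L, q = s(p.1, p.2) := by
  induction hn : B.card generalizing S B with
  | zero =>
    have hB := Finset.card_eq_zero.1 hn
    subst hB
    have : S = Finset.univ := by
      have := h.2
      exact (Finset.card_eq_iff_eq_univ S).1 (by simpa using this)
    subst this
    exact ⟨[], .nil, by simp⟩
  | succ n ih =>
    have hS : S ≠ Finset.univ := by
      rintro rfl
      rw [isRootedForest_univ.1 h] at hn
      simp at hn
    obtain ⟨e, he, s, hs, y, hy, hends⟩ := h.1.exists_crossing hS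
    have hB := Finset.insert_erase he
    rw [← hB, isRootedForest_insert_iff hends hs hy (by simp)] at h
    obtain ⟨L, hL, hq⟩ := ih h (by rw [Finset.card_erase_of_mem he, hn]; rfl)
    refine ⟨(s, y) :: L, .cons hs hy hL, fun q => ?_⟩
    rw [← hB]
    simp only [Finset.mem_insert, List.mem_cons, exists_eq_or_imp, hq, hends]
    rw [eq_comm]

/-- The rooted forests of `G` at `S` that connect each of the pairs in `L` by an edge. -/
noncomputable def forestsThrough [Fintype E] (G : MGraph V E) (S : Finset V)
    (L : List (V × V)) : Finset (Finset E) :=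
  {B | G.IsRootedForest S B ∧ ∀ q ∈ L, ∃ e ∈ B, G.ends e = s(q.1, q.2)}

/-- A forest contains only one edge from `p` to `y`, since contracting it makes both ends roots; so
`(e, B) ↦ insert e B` is a bijection. By `hL`, `e` cannot serve any later pair, as the new vertex of
such a pair is neither `p` nor `y`. -/
theorem card_forestsThrough_cons [Fintype E] (G : MGraph V E) {S : Finset V} {p y : V}
    {L : List (V × V)} (hp : p ∈ S) (hy : y ∉ S) (hL : ∀ q ∈ L, q.2 ∉ insert y S) :
    (G.forestsThrough S ((p, y) :: L)).card =
      G.edgeCount Finset.univ p y * (G.forestsThrough (insert y S) L).card := by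
  unfold edgeCount
  rw [← Finset.card_product]
  symm
  refine Finset.card_bij (fun q _ => insert q.1 q.2) ?_ ?_ ?_
  · rintro ⟨e, B⟩ h
    simp only [forestsThrough, Finset.mem_product, Finset.mem_filter, Finset.mem_univ,
      true_and] at h ⊢
    obtain ⟨he, hB, hq⟩ := h
    have heB : e ∉ B := fun h' =>
      hB.not_inside h' (Finset.mem_insert_of_mem hp) (Finset.mem_insert_self _ _) he
    refine ⟨(isRootedForest_insert_iff he hp hy heB).2 hB, ?_⟩
    intro q hqL
    rcases List.mem_cons.1 hqL with rfl | hqL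
    · exact ⟨e, by simp, he⟩
    · obtain ⟨e', he', h'⟩ := hq q hqL
      exact ⟨e', by simp [he'], h'⟩
  · rintro ⟨e, B⟩ h ⟨e', B'⟩ h' heq
    simp only [forestsThrough, Finset.mem_product, Finset.mem_filter, Finset.mem_univ,
      true_and] at h h' heq
    obtain ⟨he, hB, -⟩ := h
    obtain ⟨he', hB', -⟩ := h'
    have key : ∀ e₁ B₁, G.IsRootedForest (insert y S) B₁ → G.ends e₁ = s(p, y) → e₁ ∉ B₁ :=
      fun e₁ B₁ hB₁ h₁ h' =>
        hB₁.not_inside h' (Finset.mem_insert_of_mem hp) (Finset.mem_insert_self _ _) h₁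
    have hee : e = e' := by
      have : e ∈ insert e' B' := by rw [← heq]; simp
      rcases Finset.mem_insert.1 this with h | h
      · exact h
      · exact absurd h (key e B' hB' he)
    subst hee
    have : B = B' := by
      rw [← Finset.erase_insert (key e B hB he), heq, Finset.erase_insert (key e B' hB' he)]
    rw [this]
  · intro B hB
    simp only [forestsThrough, Finset.mem_filter, Finset.mem_univ, true_and] at hB
    obtain ⟨hB, hq⟩ := hB
    obtain ⟨e, he, hends⟩ := hq _ List.mem_cons_self
    refine ⟨(e, B.erase e), ?_, Finset.insert_erase he⟩
    simp only [forestsThrough, Finset.mem_product, Finset.mem_filter, Finset.mem_univ,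
      true_and]
    refine ⟨hends, ?_, ?_⟩
    · rw [← isRootedForest_insert_iff hends hp hy (by simp), Finset.insert_erase he]
      exact hB
    · intro q hqL
      obtain ⟨e', he', h'⟩ := hq q (List.mem_cons_of_mem _ hqL)
      refine ⟨e', Finset.mem_erase.2 ⟨?_, he'⟩, h'⟩
      rintro rfl
      have h2 : q.2 ∈ s(p, y) := by
        rw [← hends, h']; simp
      rcases Sym2.mem_iff.1 h2 with h2 | h2
      · exact hL q hqL (by rw [h2]; exact Finset.mem_insert_of_mem hp)
      · exact hL q hqL (by rw [h2]; simp)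

/-- The number of forests of `G` rooted at `S`. -/
noncomputable def forestCount [Fintype E] (G : MGraph V E) (S : Finset V) : ℕ :=
  (G.forestsThrough S []).card

theorem card_forestsThrough_map [Fintype E] (G : MGraph V E) {τ : Type*} [Fintype τ]
    {f : τ → V} (hf : Function.Injective f) {U : Finset τ} {L : List (τ × τ)} (h : Grows U L) :
    (G.forestsThrough (U.image f) (L.map (Prod.map f f))).card =
      (L.map fun q => G.edgeCount Finset.univ (f q.1) (f q.2)).prod *
        G.forestCount (Finset.univ.image f) := by
  induction h with
  | nil => simp [forestCount]
  | @cons U p y L hp hy h ih =>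
    have hmem : ∀ {W : Finset τ} {z : τ}, f z ∈ W.image f ↔ z ∈ W := by
      intro W z
      exact hf.mem_finset_image
    simp only [List.map_cons, List.prod_cons, Prod.map_apply]
    rw [card_forestsThrough_cons G (hmem.2 hp) (by rwa [hmem])]
    · rw [Finset.image_insert] at ih
      rw [ih, mul_assoc]
    · intro q hq
      obtain ⟨r, hr, rfl⟩ := List.mem_map.1 hq
      rw [← Finset.image_insert]
      simpa only [Prod.map_snd, hmem] using h.snd_notMem r hr

end RootedForests

end MGraph

namespace MGraph

/-! ### Matrix-tree theorem for rooted forests -/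

section MatrixTree

open Classical Matrix

variable {V E : Type*}

theorem edgeCount_comm (G : MGraph V E) (A : Finset E) (x y : V) :
    G.edgeCount A x y = G.edgeCount A y x := by
  unfold edgeCount
  rw [Sym2.eq_swap]

theorem edgeCount_erase (G : MGraph V E) {A : Finset E} {e : E} (he : e ∈ A) (x y : V) :
    G.edgeCount A x y =
      G.edgeCount (A.erase e) x y + if G.ends e = s(x, y) then 1 else 0 := by
  unfold edgeCount
  conv_lhs => rw [← Finset.insert_erase he]
  rw [Finset.filter_insert]
  split_ifs with h
  · rw [Finset.card_insert_of_notMem (by simp)]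
  · simp

variable [Fintype V]

/-- The Laplace matrix of the graph with edge set `A`. -/
noncomputable def laplacian (G : MGraph V E) (A : Finset E) : Matrix V V ℝ :=
  fun x y => (if x = y then ∑ w, (G.edgeCount A x w : ℝ) else 0) - G.edgeCount A x y

/-- The Laplace matrix with the rows in `S` replaced by those of the unit matrix. -/
noncomputable def rootedLaplacian (G : MGraph V E) (A : Finset E) (S : Finset V) :
    Matrix V V ℝ :=
  fun x y => if x ∈ S then (if x = y then 1 else 0) else G.laplacian A x y

theorem laplacian_mulVec (G : MGraph V E) (A : Finset E) (h : V → ℝ) (x : V) :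
    (G.laplacian A *ᵥ h) x = ∑ w, (G.edgeCount A x w : ℝ) * (h x - h w) := by
  simp [laplacian, Matrix.mulVec, dotProduct, sub_mul, mul_sub, Finset.sum_sub_distrib,
    Finset.sum_mul]

theorem laplacian_comm (G : MGraph V E) (A : Finset E) (x y : V) :
    G.laplacian A x y = G.laplacian A y x := by
  unfold laplacian
  rw [edgeCount_comm]
  by_cases h : x = y
  · subst h; rfl
  · simp [h, Ne.symm h]

theorem laplacian_erase (G : MGraph V E) {A : Finset E} {e : E} (he : e ∈ A) {s y : V}
    (hends : G.ends e = s(s, y)) (hsy : s ≠ y) (w : V) :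
    G.laplacian A y w = G.laplacian (A.erase e) y w +
      ((if w = y then 1 else 0) - if w = s then 1 else 0) := by
  have h1 : ∀ w, (G.edgeCount A y w : ℝ) =
      G.edgeCount (A.erase e) y w + if w = s then 1 else 0 := by
    intro w
    rw [G.edgeCount_erase he, hends]
    have : s(s, y) = s(y, w) ↔ w = s := by
      rw [Sym2.eq_swap, Sym2.eq_iff]
      constructor
      · rintro (⟨-, h⟩ | ⟨h, h'⟩)
        · exact h.symm
        · exact absurd h' hsy
      · rintro rfl; exact .inl ⟨rfl, rfl⟩
    simp [this]
  unfold laplacian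
  simp only [h1, Finset.sum_add_distrib, Finset.sum_ite_eq', Finset.mem_univ, if_true,
    eq_comm (a := y)]
  split_ifs <;> ring

theorem laplacian_erase_of_ne (G : MGraph V E) {A : Finset E} {e : E} (he : e ∈ A)
    {x : V} (hx : x ∉ G.ends e) (w : V) :
    G.laplacian A x w = G.laplacian (A.erase e) x w := by
  have h1 : ∀ w, G.edgeCount A x w = G.edgeCount (A.erase e) x w := by
    intro w
    rw [G.edgeCount_erase he, if_neg, add_zero]
    intro h
    exact hx (by rw [h]; simp)
  simp [laplacian, h1]

theorem rootedLaplacian_insert (G : MGraph V E) (A : Finset E) (S : Finset V) (y : V) :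
    G.rootedLaplacian A (insert y S) =
      (G.rootedLaplacian A S).updateRow y (Pi.single y 1) := by
  ext x w
  by_cases hx : x = y
  · subst hx
    simp [rootedLaplacian, Pi.single_apply, eq_comm]
  · simp [rootedLaplacian, hx]

/-- Deletion and contraction: `e` adds the difference of the unit vectors at `y` and `s` to row `y`.
Expanding in this row, the term with the unit vector at `s` vanishes because row `s` already is that
vector. -/
theorem det_rootedLaplacian_erase (G : MGraph V E) {A : Finset E} {S : Finset V} {e : E}
    (he : e ∈ A) {s y : V} (hends : G.ends e = s(s, y)) (hs : s ∈ S) (hy : y ∉ S) :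
    (G.rootedLaplacian A S).det =
      (G.rootedLaplacian (A.erase e) S).det + (G.rootedLaplacian (A.erase e) (insert y S)).det := by
  have hsy : s ≠ y := fun h => hy (h ▸ hs)
  set M := G.rootedLaplacian (A.erase e) S with hM
  have h1 : G.rootedLaplacian A S =
      M.updateRow y (M y + (Pi.single y 1 - Pi.single s 1)) := by
    ext x w
    by_cases hx : x = y
    · subst hx
      simp [hM, rootedLaplacian, hy, G.laplacian_erase he hends hsy, Pi.single_apply]
    · rw [Matrix.updateRow_ne hx]
      unfold rootedLaplacian at hM
      rw [hM]
      simp only [rootedLaplacian]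
      by_cases hxS : x ∈ S
      · simp [hxS]
      · simp only [hxS, if_false]
        apply G.laplacian_erase_of_ne he
        rw [hends, Sym2.mem_iff]
        rintro (rfl | rfl)
        · exact hxS hs
        · exact hx rfl
  rw [rootedLaplacian_insert, ← hM, h1, Matrix.det_updateRow_add, Matrix.updateRow_eq_self,
    sub_eq_add_neg, Matrix.det_updateRow_add]
  have h2 : (M.updateRow y (-Pi.single s 1)).det = 0 := by
    have : (-Pi.single s 1 : V → ℝ) = (-1 : ℝ) • (Pi.single s 1) := by simp
    rw [this, Matrix.det_updateRow_smul]
    rw [Matrix.det_zero_of_row_eq hsy, mul_zero]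
    ext w
    rw [Matrix.updateRow_self, Matrix.updateRow_ne hsy]
    simp [hM, rootedLaplacian, hs, Pi.single_apply, eq_comm]
  rw [h2, add_zero]

theorem rootedLaplacian_univ (G : MGraph V E) (A : Finset E) :
    G.rootedLaplacian A Finset.univ = 1 := by
  ext x y
  simp [rootedLaplacian, Matrix.one_apply]

/-- The indicator of the complement of `S` lies in the kernel. -/
theorem det_rootedLaplacian_eq_zero (G : MGraph V E) {A : Finset E} {S : Finset V}
    (hS : S ≠ Finset.univ) (hA : ∀ e ∈ A, ∀ s ∈ S, ∀ y ∉ S, G.ends e ≠ s(s, y)) :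
    (G.rootedLaplacian A S).det = 0 := by
  apply Matrix.exists_mulVec_eq_zero_iff.1
  obtain ⟨z, hz⟩ : ∃ z, z ∉ S := by
    by_contra! hc
    exact hS (Finset.eq_univ_iff_forall.2 hc)
  refine ⟨fun x => if x ∈ S then 0 else 1, fun h => ?_, ?_⟩
  · have := congrFun h z
    simp [hz] at this
  · ext x
    by_cases hx : x ∈ S
    · simp only [rootedLaplacian, Matrix.mulVec, dotProduct, hx, if_true, Pi.zero_apply]
      apply Finset.sum_eq_zero
      intro w _
      by_cases hw : x = w
      · simp [← hw, hx]
      · simp [hw]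
    · have : (G.rootedLaplacian A S *ᵥ fun x => if x ∈ S then 0 else 1) x =
          (G.laplacian A *ᵥ fun x => if x ∈ S then 0 else 1) x := by
        simp [rootedLaplacian, Matrix.mulVec, dotProduct, hx]
      rw [this, laplacian_mulVec]
      apply Finset.sum_eq_zero
      intro w _
      by_cases hw : w ∈ S
      · have : G.edgeCount A x w = 0 := by
          unfold edgeCount
          rw [Finset.card_eq_zero, Finset.filter_eq_empty_iff]
          intro e he h
          exact hA e he w hw x hx (by rw [h, Sym2.eq_swap])
        simp [this]
      · simp [hx, hw]

/-- Determinant and forest count obey the same recursion along an edge leaving `S`: forests avoiding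
`e` use `A.erase e`, and forests containing it become forests with one more root. -/
theorem det_rootedLaplacian (G : MGraph V E) (A : Finset E) (S : Finset V) :
    (G.rootedLaplacian A S).det = ((A.powerset.filter (G.IsRootedForest S)).card : ℝ) := by
  induction hn : A.card generalizing A S with
  | zero =>
    have hA := Finset.card_eq_zero.1 hn
    subst hA
    by_cases hS : S = Finset.univ
    · subst hS
      rw [rootedLaplacian_univ]
      simp [Finset.filter_singleton, isRootedForest_univ]
    · rw [G.det_rootedLaplacian_eq_zero hS (by simp), eq_comm, Nat.cast_eq_zero,
        Finset.card_eq_zero, Finset.filter_eq_empty_iff]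
      intro B hB h
      obtain ⟨e, he, -⟩ := h.1.exists_crossing hS
      simpa using Finset.mem_powerset.1 hB he
  | succ n ih =>
    by_cases hS : S = Finset.univ
    · subst hS
      rw [rootedLaplacian_univ, Matrix.det_one]
      have : A.powerset.filter (G.IsRootedForest Finset.univ) = {∅} := by
        ext B
        simp only [isRootedForest_univ, Finset.mem_filter, Finset.mem_powerset,
          Finset.mem_singleton]
        constructor
        · exact fun h => h.2
        · rintro rfl; simp
      simp [this]
    by_cases hA : ∃ e ∈ A, ∃ s ∈ S, ∃ y ∉ S, G.ends e = s(s, y)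
    · obtain ⟨e, he, s, hs, y, hy, hends⟩ := hA
      have hc : (A.erase e).card = n := by rw [Finset.card_erase_of_mem he, hn]; rfl
      rw [G.det_rootedLaplacian_erase he hends hs hy, ih _ _ hc, ih _ _ hc, ← Nat.cast_add]
      congr 1
      rw [← Finset.card_filter_add_card_filter_not (s := A.powerset.filter (G.IsRootedForest S))
        (fun B => e ∉ B)]
      congr 1
      · congr 1
        ext B
        simp only [Finset.mem_filter, Finset.mem_powerset, Finset.subset_erase]
        tauto
      · refine Finset.card_bij (fun B _ => insert e B) ?_ ?_ ?_
        · intro B hB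
          simp only [Finset.mem_filter, Finset.mem_powerset, Finset.subset_erase] at hB ⊢
          exact ⟨⟨Finset.insert_subset he hB.1.1,
            (isRootedForest_insert_iff hends hs hy hB.1.2).2 hB.2⟩, by simp⟩
        · intro B hB B' hB' h
          simp only [Finset.mem_filter, Finset.mem_powerset, Finset.subset_erase] at hB hB' h
          rw [← Finset.erase_insert hB.1.2, h, Finset.erase_insert hB'.1.2]
        · intro B hB
          simp only [Finset.mem_filter, Finset.mem_powerset, not_not] at hB
          refine ⟨B.erase e, ?_, Finset.insert_erase hB.2⟩
          simp only [Finset.mem_filter, Finset.mem_powerset]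
          refine ⟨Finset.erase_subset_erase _ hB.1.1, ?_⟩
          rw [← isRootedForest_insert_iff hends hs hy (by simp), Finset.insert_erase hB.2]
          exact hB.1.2
    · rw [G.det_rootedLaplacian_eq_zero hS (by
        intro e he s hs y hy h
        exact hA ⟨e, he, s, hs, y, hy, h⟩), eq_comm, Nat.cast_eq_zero,
        Finset.card_eq_zero, Finset.filter_eq_empty_iff]
      intro B hB h
      obtain ⟨e, he, h'⟩ := h.1.exists_crossing hS
      exact hA ⟨e, Finset.mem_powerset.1 hB he, h'⟩

theorem det_rootedLaplacian_univ [Fintype E] (G : MGraph V E) (S : Finset V) :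
    (G.rootedLaplacian Finset.univ S).det = G.forestCount S := by
  rw [det_rootedLaplacian]
  unfold forestCount forestsThrough
  congr 2
  ext B
  simp

end MatrixTree

end MGraph

namespace MGraph

/-! ### Hitting probabilities as harmonic functions -/

section Hitting

open Classical Matrix

variable {V E : Type*} [Fintype E]

theorem stepProb_eq (G : MGraph V E) (x y : V) :
    G.stepProb x y = (G.edgeCount Finset.univ x y : ℝ) / G.degree x := rfl

theorem stepProb_nonneg (G : MGraph V E) (x y : V) : 0 ≤ G.stepProb x y := by
  rw [stepProb_eq]; positivity

theorem pathProb_cons (G : MGraph V E) {k : ℕ} (a : V) (γ : Fin (k + 1) → V) :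
    G.pathProb (Fin.cons a γ : Fin (k + 2) → V) = G.stepProb a (γ 0) * G.pathProb γ := by
  unfold pathProb
  rw [Fin.prod_univ_succ]
  simp

variable [Fintype V]

/-- A self-edge at `x` is counted once, in the term `w = x`, in agreement with `degree`. -/
theorem sum_edgeCount (G : MGraph V E) (x : V) :
    ∑ w, G.edgeCount Finset.univ x w = G.degree x := by
  simp only [edgeCount, degree, Finset.card_filter]
  rw [Finset.sum_comm]
  refine Finset.sum_congr rfl fun e _ => ?_
  by_cases hx : x ∈ G.ends e
  · obtain ⟨w, hw⟩ := Sym2.mem_iff_exists.1 hx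
    rw [if_pos hx, Finset.sum_eq_single w]
    · simp [hw]
    · intro w' _ h
      rw [hw, if_neg]
      exact fun h' => h (Sym2.congr_right.1 h').symm
    · simp
  · rw [if_neg hx]
    apply Finset.sum_eq_zero
    intro w _
    rw [if_neg]
    intro h
    exact hx (by rw [h]; simp)

/-- Only an inequality: at a vertex of degree 0 all step probabilities are 0. -/
theorem sum_stepProb_le_one (G : MGraph V E) (x : V) : ∑ w, G.stepProb x w ≤ 1 := by
  simp only [stepProb_eq]
  rw [← Finset.sum_div, ← Nat.cast_sum, sum_edgeCount]
  exact div_self_le_one _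

/-- The probability that the walk from `x` is in `{y, z}` for the first time at time `k`, and is
then at `y`. -/
noncomputable def firstHitProb (G : MGraph V E) (y z : V) (k : ℕ) (x : V) : ℝ :=
  ∑ γ : Fin (k + 1) → V with
    (γ 0 = x ∧ γ (Fin.last k) = y ∧ ∀ i : Fin k, γ i.castSucc ≠ y ∧ γ i.castSucc ≠ z),
    G.pathProb γ

theorem hitBeforeProb_eq (G : MGraph V E) (x y z : V) :
    G.hitBeforeProb x y z = ∑' k, G.firstHitProb y z k x := rfl

theorem firstHitProb_zero (G : MGraph V E) (y z x : V) :
    G.firstHitProb y z 0 x = if x = y then 1 else 0 := by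
  unfold firstHitProb
  rw [Finset.sum_filter, ← (Equiv.funUnique (Fin 1) V).symm.sum_comp]
  simp only [pathProb, Finset.univ_eq_empty, Finset.prod_empty, IsEmpty.forall_iff, and_true]
  rw [Finset.sum_eq_single x]
  · simp
  · intro w _ hw
    simp [hw]
  · simp

theorem firstHitProb_succ (G : MGraph V E) (y z : V) (k : ℕ) (x : V) :
    G.firstHitProb y z (k + 1) x =
      if x = y ∨ x = z then 0 else ∑ w, G.stepProb x w * G.firstHitProb y z k w := by
  have hR : ∑ w, G.stepProb x w * G.firstHitProb y z k w =
      ∑ γ : Fin (k + 1) → V, if (γ (Fin.last k) = y ∧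
        ∀ i : Fin k, γ i.castSucc ≠ y ∧ γ i.castSucc ≠ z) then
          G.stepProb x (γ 0) * G.pathProb γ else 0 := by
    simp only [firstHitProb, Finset.sum_filter, Finset.mul_sum]
    rw [Finset.sum_comm]
    refine Finset.sum_congr rfl fun γ _ => ?_
    rw [Finset.sum_eq_single (γ 0)]
    · simp
    · intro w _ hw
      simp [hw.symm]
    · simp
  rw [hR]
  unfold firstHitProb
  rw [Finset.sum_filter, ← (Fin.consEquiv fun _ => V).sum_comp, Fintype.sum_prod_type,
    Finset.sum_eq_single x]
  · split_ifs with h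
    · apply Finset.sum_eq_zero
      intro γ _
      rw [if_neg]
      rintro ⟨-, -, h3⟩
      have := h3 0
      simp [Fin.consEquiv] at this
      tauto
    · refine Finset.sum_congr rfl fun γ _ => ?_
      have e1 : (Fin.consEquiv fun _ => V) (x, γ) = (Fin.cons x γ : Fin (k + 2) → V) := rfl
      rw [e1, pathProb_cons]
      congr 1
      rw [Fin.forall_fin_succ]
      simp only [Fin.cons_zero, true_and, ← Fin.succ_last, Fin.cons_succ, Fin.castSucc_zero,
        ← Fin.succ_castSucc]
      simp only [eq_iff_iff]
      tauto
  · intro w _ hw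
    apply Finset.sum_eq_zero
    intro γ _
    rw [if_neg]
    rintro ⟨h, -⟩
    exact hw h
  · simp

theorem firstHitProb_nonneg (G : MGraph V E) (y z : V) (k : ℕ) (x : V) :
    0 ≤ G.firstHitProb y z k x :=
  Finset.sum_nonneg fun _ _ => Finset.prod_nonneg fun _ _ => G.stepProb_nonneg _ _

/-- Conditioning on the first step bounds the partial sums, so the series for `hitBeforeProb`
converges. -/
theorem sum_firstHitProb_le_one (G : MGraph V E) (y z : V) (K : ℕ) (x : V) :
    ∑ k ∈ Finset.range K, G.firstHitProb y z k x ≤ 1 := by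
  induction K generalizing x with
  | zero => simp
  | succ K ih =>
    rw [Finset.sum_range_succ', firstHitProb_zero]
    simp only [firstHitProb_succ]
    by_cases h : x = y ∨ x = z
    · simp only [h, if_true, Finset.sum_const_zero, zero_add]
      split_ifs <;> simp
    · have hxy : x ≠ y := fun h' => h (.inl h')
      rw [if_neg hxy, add_zero]
      simp only [if_neg h]
      rw [Finset.sum_comm]
      simp only [← Finset.mul_sum]
      calc _ ≤ ∑ w, G.stepProb x w * 1 := Finset.sum_le_sum fun w _ =>
              mul_le_mul_of_nonneg_left (ih w) (G.stepProb_nonneg x w)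
        _ ≤ 1 := by simpa using G.sum_stepProb_le_one x

theorem summable_firstHitProb (G : MGraph V E) (y z x : V) :
    Summable fun k => G.firstHitProb y z k x :=
  summable_of_sum_range_le (fun k => G.firstHitProb_nonneg y z k x)
    fun K => G.sum_firstHitProb_le_one y z K x

theorem hitBeforeProb_self (G : MGraph V E) (y z : V) : G.hitBeforeProb y y z = 1 := by
  rw [hitBeforeProb_eq, (G.summable_firstHitProb y z y).tsum_eq_zero_add]
  simp [firstHitProb_succ, firstHitProb_zero]

theorem hitBeforeProb_right (G : MGraph V E) {y z : V} (h : y ≠ z) :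
    G.hitBeforeProb z y z = 0 := by
  rw [hitBeforeProb_eq, (G.summable_firstHitProb y z z).tsum_eq_zero_add]
  simp [firstHitProb_succ, firstHitProb_zero, h.symm]

theorem hitBeforeProb_step (G : MGraph V E) {x y z : V} (hy : x ≠ y) (hz : x ≠ z) :
    G.hitBeforeProb x y z = ∑ w, G.stepProb x w * G.hitBeforeProb w y z := by
  rw [hitBeforeProb_eq, (G.summable_firstHitProb y z x).tsum_eq_zero_add]
  simp only [firstHitProb_succ, firstHitProb_zero, hy, hz, or_self, if_false, zero_add]
  rw [Summable.tsum_finsetSum fun w _ => (G.summable_firstHitProb y z w).mul_left _]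
  simp only [tsum_mul_left, hitBeforeProb_eq]

theorem laplacian_mulVec_hitBeforeProb (G : MGraph V E) {x y z : V} (hy : x ≠ y) (hz : x ≠ z) :
    (G.laplacian Finset.univ *ᵥ fun w => G.hitBeforeProb w y z) x = 0 := by
  rw [laplacian_mulVec]
  simp only [mul_sub, Finset.sum_sub_distrib]
  rw [← Finset.sum_mul, ← Nat.cast_sum, sum_edgeCount, sub_eq_zero]
  by_cases hd : G.degree x = 0
  · have h0 : ∀ w, G.edgeCount Finset.univ x w = 0 := by
      intro w
      have := G.sum_edgeCount x
      rw [hd, Finset.sum_eq_zero_iff] at this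
      exact this w (Finset.mem_univ w)
    simp [hd, h0]
  · have hd' : (G.degree x : ℝ) ≠ 0 := by exact_mod_cast hd
    rw [G.hitBeforeProb_step hy hz, Finset.mul_sum]
    refine Finset.sum_congr rfl fun w _ => ?_
    rw [stepProb_eq]
    field_simp

/-! ### Green function of the killed walk -/

theorem Connected.forestCount_pos {G : MGraph V E} (hG : G.Connected) {S : Finset V}
    (hS : S.Nonempty) : 0 < G.forestCount S := by
  obtain ⟨s, hs⟩ := hS
  have h : G.Covers S Finset.univ := fun z => ⟨s, hs, by
    rw [Finset.coe_univ]; exact SimpleGraph.Connected.preconnected hG z s⟩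
  obtain ⟨B, hB⟩ := h.exists_isRootedForest
  exact Finset.card_pos.2 ⟨B, by simpa [forestsThrough] using hB⟩

theorem forestCount_singleton (G : MGraph V E) (v : V) :
    G.forestCount {v} = G.spanningTrees.card := by
  unfold forestCount spanningTrees forestsThrough
  congr 1
  ext B
  simp [isSpanningTree_iff_isRootedForest v]

/-- The Green function of the walk killed at `z`, relative to the counting measure. -/
noncomputable def green (G : MGraph V E) (z : V) : Matrix V V ℝ :=
  (G.rootedLaplacian Finset.univ {z})⁻¹

variable {G : MGraph V E}

theorem Connected.isUnit_det (hG : G.Connected) (z : V) :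
    IsUnit (G.rootedLaplacian Finset.univ {z}).det := by
  rw [det_rootedLaplacian_univ, isUnit_iff_ne_zero]
  exact_mod_cast (hG.forestCount_pos (by simp)).ne'

/-- By Cramer's rule the numerator is the determinant with row `y` replaced by a unit row, which
makes `y` a second root. -/
theorem green_diag (G : MGraph V E) (y z : V) :
    G.green z y y = (G.forestCount {y, z} : ℝ) / G.spanningTrees.card := by
  unfold green
  rw [Matrix.inv_def, Matrix.smul_apply, Matrix.adjugate_apply, ← rootedLaplacian_insert,
    det_rootedLaplacian_univ, det_rootedLaplacian_univ, forestCount_singleton,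
    Ring.inverse_eq_inv', smul_eq_mul, div_eq_inv_mul]

/-- This symmetry allows Green functions killed at different vertices to be compared. -/
theorem green_diag_comm (G : MGraph V E) (y z : V) : G.green z y y = G.green y z z := by
  rw [green_diag, green_diag, Finset.pair_comm]

theorem Connected.green_diag_pos (hG : G.Connected) (y z : V) : 0 < G.green z y y := by
  rw [green_diag, ← G.forestCount_singleton z]
  have h1 := hG.forestCount_pos (S := {y, z}) (by simp)
  have h2 := hG.forestCount_pos (S := {z}) (by simp)
  positivity

theorem rootedLaplacian_mulVec (G : MGraph V E) (z : V) (h : V → ℝ) (x : V) :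
    (G.rootedLaplacian Finset.univ {z} *ᵥ h) x =
      if x = z then h z else (G.laplacian Finset.univ *ᵥ h) x := by
  by_cases hx : x = z
  · subst hx
    simp [rootedLaplacian, Matrix.mulVec, dotProduct]
  · simp [rootedLaplacian, Matrix.mulVec, dotProduct, hx]

theorem Connected.rootedLaplacian_mulVec_green (hG : G.Connected) (z x y : V) :
    (G.rootedLaplacian Finset.univ {z} *ᵥ fun w => G.green z w y) x =
      if x = y then 1 else 0 := by
  have := congrFun (congrFun (Matrix.mul_nonsing_inv _ (hG.isUnit_det z)) x) y
  rw [Matrix.one_apply] at this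
  exact this

theorem Connected.green_left (hG : G.Connected) {y z : V} (h : y ≠ z) : G.green z z y = 0 := by
  have := hG.rootedLaplacian_mulVec_green z z y
  rwa [rootedLaplacian_mulVec, if_pos rfl, if_neg h.symm] at this

theorem Connected.laplacian_mulVec_green (hG : G.Connected) {x z : V} (y : V) (h : x ≠ z) :
    (G.laplacian Finset.univ *ᵥ fun w => G.green z w y) x = if x = y then 1 else 0 := by
  have := hG.rootedLaplacian_mulVec_green z x y
  rwa [rootedLaplacian_mulVec, if_neg h] at this

/-- Pair one column with the Laplacian of the other: only one term survives, since columns vanish at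
`z`. The full Laplacian is symmetric, unlike `rootedLaplacian`. -/
theorem Connected.green_comm (hG : G.Connected) {x y z : V} (hx : x ≠ z) (hy : y ≠ z) :
    G.green z x y = G.green z y x := by
  have key : ∀ x y, x ≠ z → y ≠ z →
      (fun w => G.green z w x) ⬝ᵥ (G.laplacian Finset.univ *ᵥ fun w => G.green z w y) =
        G.green z y x := by
    intro x y hx hy
    unfold dotProduct
    rw [Finset.sum_eq_single y]
    · rw [hG.laplacian_mulVec_green y hy]; simp
    · intro w _ hw
      by_cases hwz : w = z
      · simp only [hwz, hG.green_left hx, zero_mul]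
      · rw [hG.laplacian_mulVec_green y hwz, if_neg hw, mul_zero]
    · simp
  rw [← key x y hx hy, ← key y x hy hx, Matrix.dotProduct_mulVec, dotProduct_comm]
  congr 1
  rw [← Matrix.mulVec_transpose]
  congr 1
  ext a b
  exact G.laplacian_comm _ _ _

/-- The hitting probability vanishes at `z` and is harmonic off `{y, z}`, so the rooted Laplacian
maps it to a multiple of the unit vector at `y`. -/
theorem Connected.hitBeforeProb_eq_green (hG : G.Connected) {y z : V} (h : y ≠ z) (x : V) :
    G.hitBeforeProb x y z =
      (G.laplacian Finset.univ *ᵥ fun w => G.hitBeforeProb w y z) y * G.green z x y := by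
  set c := (G.laplacian Finset.univ *ᵥ fun w => G.hitBeforeProb w y z) y with hc
  have h1 : (G.rootedLaplacian Finset.univ {z} *ᵥ fun w => G.hitBeforeProb w y z) =
      Pi.single y c := by
    ext x
    rw [rootedLaplacian_mulVec]
    by_cases hx : x = z
    · subst hx
      rw [if_pos rfl, G.hitBeforeProb_right h, Pi.single_eq_of_ne h.symm]
    · rw [if_neg hx]
      by_cases hxy : x = y
      · subst hxy
        simp [hc]
      · rw [G.laplacian_mulVec_hitBeforeProb hxy hx, Pi.single_eq_of_ne hxy]
  have h2 := congrArg (fun f => (G.green z *ᵥ f) x) h1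
  simp only [Matrix.mulVec_mulVec] at h2
  unfold green at h2
  rw [Matrix.nonsing_inv_mul _ (hG.isUnit_det z), Matrix.one_mulVec,
    Matrix.mulVec_single] at h2
  simpa [green, mul_comm] using h2

/-- Effective resistance times effective conductance: the sum is the rate of escape from `y` to `z`
before returning. -/
theorem Connected.green_diag_mul_sum (hG : G.Connected) {y z : V} (h : y ≠ z) :
    G.green z y y *
      ∑ w, (G.edgeCount Finset.univ y w : ℝ) * (1 - G.hitBeforeProb w y z) = 1 := by
  have := hG.hitBeforeProb_eq_green h y
  rw [laplacian_mulVec, hitBeforeProb_self] at this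
  rw [mul_comm, ← this]

theorem Connected.green_eq (hG : G.Connected) {y z : V} (h : y ≠ z) (x : V) :
    G.green z x y = G.hitBeforeProb x y z * G.green z y y := by
  have h1 := hG.hitBeforeProb_eq_green h x
  have h2 := hG.hitBeforeProb_eq_green h y
  rw [hitBeforeProb_self] at h2
  rw [h1, mul_right_comm, ← h2, one_mul]

end Hitting

end MGraph

namespace MGraph

/-! ### Near-constancy of Green function and degrees -/

section Estimates

open Classical Matrix

variable {V E : Type*} [Fintype V] [Fintype E] {G : MGraph V E}

/-- Symmetry of `green` equates two products of a diagonal entry with a hitting probability within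
`ε` of 1/2. The ratio of diagonal entries is thus at most `(1/2 + ε) / (1/2 - ε) ≤ 1 + 5 * ε`. -/
theorem Connected.green_diag_le (hG : G.Connected) {ε : ℝ} (hε : 0 ≤ ε) (hε' : ε ≤ 1 / 100)
    (hhit : ∀ x y z : V, x ≠ y → x ≠ z → y ≠ z → |G.hitBeforeProb x y z - 1 / 2| ≤ ε)
    {x y z : V} (hx : x ≠ z) (hy : y ≠ z) :
    G.green z y y ≤ (1 + 5 * ε) * G.green z x x := by
  have px := hG.green_diag_pos x z
  have py := hG.green_diag_pos y z
  by_cases hxy : x = y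
  · subst hxy
    nlinarith
  have h1 := hG.green_comm hx hy
  rw [hG.green_eq hy, hG.green_eq hx] at h1
  have h2 := abs_le.1 (hhit x y z hxy hx hy)
  have h3 := abs_le.1 (hhit y x z (Ne.symm hxy) hy hx)
  have h4 : (1 / 2 - ε) * G.green z y y ≤ (1 / 2 + ε) * G.green z x x := by
    calc _ ≤ G.hitBeforeProb x y z * G.green z y y :=
          mul_le_mul_of_nonneg_right (by linarith) py.le
      _ = _ := h1
      _ ≤ _ := mul_le_mul_of_nonneg_right (by linarith) px.le
  have h5 : (1 / 2 + ε) * G.green z x x ≤ (1 / 2 - ε) * ((1 + 5 * ε) * G.green z x x) := by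
    rw [← mul_assoc]
    apply mul_le_mul_of_nonneg_right _ px.le
    nlinarith
  exact le_of_mul_le_mul_left (h4.trans h5) (by linarith)

/-- At most two comparisons are needed: `(u, v)` to `(y, v)`, then, with the pair swapped, `(v, y)`
to `(z, y)`. Their joint cost is `(1 + 5 * ε) ^ 2 ≤ 1 + 11 * ε`. -/
theorem Connected.green_diag_near (hG : G.Connected) {ε : ℝ} (hε : 0 ≤ ε)
    (hε' : ε ≤ 1 / 100)
    (hhit : ∀ x y z : V, x ≠ y → x ≠ z → y ≠ z → |G.hitBeforeProb x y z - 1 / 2| ≤ ε)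
    {u v : V} (huv : u ≠ v) {y z : V} (hyz : y ≠ z) :
    |G.green z y y - G.green v u u| ≤ 11 * ε * G.green v u u := by
  set r := G.green v u u with hr
  have pr : 0 < r := hG.green_diag_pos u v
  have key : ∀ {x y z : V}, x ≠ z → y ≠ z → G.green z y y ≤ (1 + 5 * ε) * G.green z x x :=
    fun hx hy => hG.green_diag_le hε hε' hhit hx hy
  have h1 : ∀ b, b ≠ v → G.green v b b ≤ (1 + 5 * ε) * r ∧ r ≤ (1 + 5 * ε) * G.green v b b :=
    fun b hb => ⟨key huv hb, key hb huv⟩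
  have h2 : ∀ y z, y ≠ z → G.green z y y ≤ (1 + 5 * ε) * ((1 + 5 * ε) * r) ∧
      r ≤ (1 + 5 * ε) * ((1 + 5 * ε) * G.green z y y) := by
    intro y z hyz
    have pz := hG.green_diag_pos y z
    have hw : ∀ a : ℝ, 0 ≤ a → a ≤ (1 + 5 * ε) * a := fun a ha => by nlinarith
    have h5 : (0 : ℝ) ≤ 1 + 5 * ε := by linarith
    by_cases hy : y = v
    · subst hy
      rw [green_diag_comm] at pz ⊢
      obtain ⟨a, b⟩ := h1 z hyz.symm
      exact ⟨a.trans (hw _ (by positivity)), b.trans (hw _ (by positivity))⟩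
    · obtain ⟨a, b⟩ := h1 y hy
      have c1 := key (x := v) (y := z) (z := y) (Ne.symm hy) hyz.symm
      have c2 := key (x := z) (y := v) (z := y) hyz.symm (Ne.symm hy)
      rw [G.green_diag_comm z y, G.green_diag_comm v y] at c1 c2
      exact ⟨c1.trans (mul_le_mul_of_nonneg_left a h5),
        b.trans (mul_le_mul_of_nonneg_left c2 h5)⟩
  obtain ⟨a, b⟩ := h2 y z hyz
  have pz := hG.green_diag_pos y z
  have hq : (1 + 5 * ε) * (1 + 5 * ε) ≤ 1 + 11 * ε := by nlinarith
  rw [← mul_assoc] at a b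
  have a' := a.trans (mul_le_mul_of_nonneg_right hq pr.le)
  have b' := b.trans (mul_le_mul_of_nonneg_right hq pz.le)
  rw [abs_le]
  constructor <;> nlinarith

theorem Connected.green_near (hG : G.Connected) {ε : ℝ} (hε : 0 ≤ ε) (hε' : ε ≤ 1 / 100)
    (hhit : ∀ x y z : V, x ≠ y → x ≠ z → y ≠ z → |G.hitBeforeProb x y z - 1 / 2| ≤ ε)
    {u v : V} (huv : u ≠ v) {a b : V} (ha : a ≠ v) (hb : b ≠ v) :
    |G.green v a b / G.green v u u - if a = b then 1 else 1 / 2| ≤ 30 * ε := by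
  have hR := hG.green_diag_near hε hε' hhit huv hb
  set r := G.green v u u with hr
  have pr : 0 < r := hG.green_diag_pos u v
  have hdiv : |G.green v b b / r - 1| ≤ 11 * ε := by
    rw [div_sub_one pr.ne', abs_div, abs_of_pos pr, div_le_iff₀ pr]
    exact hR
  by_cases hab : a = b
  · subst hab
    rw [if_pos rfl]
    linarith
  · rw [if_neg hab, hG.green_eq hb, mul_div_assoc]
    set q := G.green v b b / r
    have h1 := hhit a b v hab ha hb
    set h := G.hitBeforeProb a b v
    have : h * q - 1 / 2 = (h - 1 / 2) * (q - 1) + (h - 1 / 2) + (q - 1) / 2 := by ring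
    rw [this]
    calc _ ≤ |(h - 1 / 2) * (q - 1)| + |h - 1 / 2| + |(q - 1) / 2| := abs_add_three _ _ _
      _ = |h - 1 / 2| * |q - 1| + |h - 1 / 2| + |q - 1| / 2 := by
          rw [abs_mul, abs_div, abs_two]
      _ ≤ ε * (11 * ε) + ε + 11 * ε / 2 := by gcongr
      _ ≤ 30 * ε := by nlinarith

/-- The number of edges that connect `y` to another vertex. -/
noncomputable def properDegree (G : MGraph V E) (y : V) : ℝ :=
  ∑ w ∈ Finset.univ.erase y, (G.edgeCount Finset.univ y w : ℝ)

/-- Edges from `y` to `z` carry weight 1 instead of about 1/2, whence the additional `edgeCount`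
term. -/
theorem sum_mul_one_sub_hit_near {ε : ℝ} (hε : 0 ≤ ε)
    (hhit : ∀ x y z : V, x ≠ y → x ≠ z → y ≠ z → |G.hitBeforeProb x y z - 1 / 2| ≤ ε)
    {y z : V} (hyz : y ≠ z) :
    |∑ w, (G.edgeCount Finset.univ y w : ℝ) * (1 - G.hitBeforeProb w y z) -
      (G.properDegree y + G.edgeCount Finset.univ y z) / 2| ≤ ε * G.properDegree y := by
  have hz : z ∈ (Finset.univ : Finset V).erase y := by simp [hyz.symm]
  unfold properDegree
  rw [← Finset.add_sum_erase _ _ (Finset.mem_univ y), hitBeforeProb_self, sub_self, mul_zero,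
    zero_add, ← Finset.add_sum_erase _ _ hz, ← Finset.add_sum_erase _ _ hz,
    G.hitBeforeProb_right hyz]
  have h0 : ((G.edgeCount Finset.univ y z : ℝ) * (1 - 0) +
      ∑ w ∈ (Finset.univ.erase y).erase z,
        (G.edgeCount Finset.univ y w : ℝ) * (1 - G.hitBeforeProb w y z)) -
      (G.edgeCount Finset.univ y z +
        ∑ w ∈ (Finset.univ.erase y).erase z, (G.edgeCount Finset.univ y w : ℝ) +
        G.edgeCount Finset.univ y z) / 2 =
      ∑ w ∈ (Finset.univ.erase y).erase z,
        (G.edgeCount Finset.univ y w : ℝ) * (1 / 2 - G.hitBeforeProb w y z) := by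
    simp only [mul_sub, Finset.sum_sub_distrib, ← Finset.sum_mul]
    ring
  rw [h0]
  calc _ ≤ ∑ w ∈ (Finset.univ.erase y).erase z,
        |(G.edgeCount Finset.univ y w : ℝ) * (1 / 2 - G.hitBeforeProb w y z)| :=
        Finset.abs_sum_le_sum_abs _ _
    _ ≤ ∑ w ∈ (Finset.univ.erase y).erase z, ε * (G.edgeCount Finset.univ y w : ℝ) := by
        refine Finset.sum_le_sum fun w hw => ?_
        simp only [Finset.mem_erase, Finset.mem_univ, and_true] at hw
        rw [abs_mul, Nat.abs_cast, mul_comm, abs_sub_comm]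
        exact mul_le_mul_of_nonneg_right (hhit w y z hw.2 hw.1 hyz) (by positivity)
    _ ≤ _ := by
        rw [← Finset.mul_sum]
        exact mul_le_mul_of_nonneg_left (le_add_of_nonneg_left (by positivity)) hε

/-- By `green_diag_mul_sum`, `(d + edgeCount y z) * r / 2` is about 1 for every `z ≠ y`. A `z` with
few edges to `y` gives `d * r / 2 ≈ 1`; then an arbitrary `z` leaves little room for its own edges.
-/
theorem Connected.degree_near (hG : G.Connected) {ε : ℝ} (hε : 0 < ε) (hε' : ε ≤ 1 / 100)
    (hcard : 1 / ε + 1 ≤ Fintype.card V)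
    (hhit : ∀ x y z : V, x ≠ y → x ≠ z → y ≠ z → |G.hitBeforeProb x y z - 1 / 2| ≤ ε)
    {u v : V} (huv : u ≠ v) (y : V) :
    |G.properDegree y * G.green v u u / 2 - 1| ≤ 30 * ε ∧
      ∀ z, y ≠ z → G.edgeCount Finset.univ y z * G.green v u u / 2 ≤ 30 * ε := by
  have pr : 0 < G.green v u u := hG.green_diag_pos u v
  set r := G.green v u u with hr
  set d := G.properDegree y with hd
  have hd0 : 0 ≤ d := Finset.sum_nonneg fun _ _ => by positivity
  have key : ∀ z, y ≠ z →
      (1 - 11 * ε) * ((1 - 2 * ε) * (d * r / 2) + G.edgeCount Finset.univ y z * r / 2) ≤ 1 ∧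
      1 ≤ (1 + 11 * ε) * ((1 + 2 * ε) * (d * r / 2) + G.edgeCount Finset.univ y z * r / 2) := by
    intro z hyz
    have h1 := hG.green_diag_mul_sum hyz
    have h2 := abs_le.1 (sum_mul_one_sub_hit_near hε.le hhit hyz)
    have h3 := abs_le.1 (hG.green_diag_near hε.le hε' hhit huv hyz)
    rw [← hr] at h3
    rw [← hd] at h2
    set q := ∑ w, (G.edgeCount Finset.univ y w : ℝ) * (1 - G.hitBeforeProb w y z)
    set c : ℝ := (G.edgeCount Finset.univ y z : ℝ)
    have hc : 0 ≤ c := by positivity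
    have pR := hG.green_diag_pos y z
    set R := G.green z y y
    have hl : 0 ≤ (1 / 2 - ε) * d + c / 2 :=
      add_nonneg (mul_nonneg (by linarith) hd0) (by linarith)
    constructor
    · calc _ = ((1 - 11 * ε) * r) * ((1 / 2 - ε) * d + c / 2) := by ring
        _ ≤ R * q := mul_le_mul (by linarith) (by linarith) hl pR.le
        _ = 1 := h1
    · calc 1 = R * q := h1.symm
        _ ≤ ((1 + 11 * ε) * r) * ((1 / 2 + ε) * d + c / 2) :=
            mul_le_mul (by linarith) (by linarith) (by linarith) (by positivity)
        _ = _ := by ring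
  have hN : 1 / ε ≤ (((Finset.univ : Finset V).erase y).card : ℝ) := by
    rw [Finset.card_erase_of_mem (Finset.mem_univ y), Finset.card_univ, Nat.cast_sub
      (Fintype.card_pos_iff.2 ⟨y⟩)]
    simp only [Nat.cast_one]; linarith
  -- Pigeonhole: at least `1 / ε` other vertices share the `d` edges.
  obtain ⟨z₀, hz₀, hc₀⟩ : ∃ z, y ≠ z ∧ (G.edgeCount Finset.univ y z : ℝ) ≤ ε * d := by
    by_contra! hcon
    have h1 : (((Finset.univ : Finset V).erase y).card : ℝ) * (ε * d) ≤ d := by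
      rw [← nsmul_eq_mul, hd]
      apply Finset.card_nsmul_le_sum
      intro z hz
      exact (hcon z (Finset.ne_of_mem_erase hz).symm).le
    have hne : ((Finset.univ : Finset V).erase y).Nonempty := by
      rw [← Finset.card_pos]
      have : (0 : ℝ) < (((Finset.univ : Finset V).erase y).card : ℝ) :=
        lt_of_lt_of_le (by positivity) hN
      exact_mod_cast this
    have h2 : (((Finset.univ : Finset V).erase y).card : ℝ) * (ε * d) < d := by
      rw [← nsmul_eq_mul, hd]
      conv_rhs => unfold properDegree
      rw [← Finset.sum_const]
      exact Finset.sum_lt_sum_of_nonempty hne fun z hz =>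
        hcon z (Finset.ne_of_mem_erase hz).symm
    have h3 : 1 / ε * (ε * d) ≤ (((Finset.univ : Finset V).erase y).card : ℝ) * (ε * d) :=
      mul_le_mul_of_nonneg_right hN (by positivity)
    have h4 : 1 / ε * (ε * d) = d := by field_simp
    linarith
  set w := d * r / 2 with hw
  have hw0 : 0 ≤ w := by positivity
  have hw1 : w ≤ 1 + 15 * ε := by
    obtain ⟨a, -⟩ := key z₀ hz₀
    have hs : 0 ≤ G.edgeCount Finset.univ y z₀ * r / 2 := by positivity
    have h1 : (1 - 13 * ε) * w ≤ 1 := by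
      calc _ ≤ (1 - 11 * ε) * (1 - 2 * ε) * w := mul_le_mul_of_nonneg_right (by nlinarith) hw0
        _ = (1 - 11 * ε) * ((1 - 2 * ε) * w) := by ring
        _ ≤ _ := mul_le_mul_of_nonneg_left (le_add_of_nonneg_right hs) (by linarith)
        _ ≤ 1 := a
    have h2 : 1 ≤ (1 - 13 * ε) * (1 + 15 * ε) := by nlinarith
    exact le_of_mul_le_mul_left (h1.trans h2) (by linarith)
  have hw2 : 1 - 15 * ε ≤ w := by
    obtain ⟨-, b⟩ := key z₀ hz₀
    have hs : G.edgeCount Finset.univ y z₀ * r / 2 ≤ ε * w := by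
      rw [hw]
      calc _ = G.edgeCount Finset.univ y z₀ * (r / 2) := by ring
        _ ≤ (ε * d) * (r / 2) := mul_le_mul_of_nonneg_right hc₀ (by positivity)
        _ = _ := by ring
    have h1 : 1 ≤ (1 + 11 * ε) * ((1 + 3 * ε) * w) :=
      b.trans (mul_le_mul_of_nonneg_left (by linarith) (by linarith))
    have h2 : (1 + 11 * ε) * (1 + 3 * ε) ≤ 1 + 15 * ε := by nlinarith
    have h3 : 1 ≤ (1 + 15 * ε) * w := by
      rw [← mul_assoc] at h1
      exact h1.trans (mul_le_mul_of_nonneg_right h2 hw0)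
    nlinarith
  refine ⟨abs_le.2 ⟨by linarith, by linarith⟩, fun z hyz => ?_⟩
  obtain ⟨a, -⟩ := key z hyz
  set s := G.edgeCount Finset.univ y z * r / 2
  have h1 : (1 - 2 * ε) * w + s ≤ 1 + 13 * ε := by
    have h2 : 1 ≤ (1 - 11 * ε) * (1 + 13 * ε) := by nlinarith
    exact le_of_mul_le_mul_left (a.trans h2) (by linarith)
  nlinarith

end Estimates

/-! ### The limiting determinant, and forest counts as Green minors -/

section Determinants

open Classical Matrix

/-- The matrix is half the sum of the identity and a rank-one matrix with eigenvalue `Fintype.card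
σ`. -/
theorem det_one_half_matrix (σ : Type*) [Fintype σ] [DecidableEq σ] :
    (Matrix.of fun a b : σ => if a = b then (1 : ℝ) else 1 / 2).det =
      (Fintype.card σ + 1) / 2 ^ Fintype.card σ := by
  have h : (Matrix.of fun a b : σ => if a = b then (1 : ℝ) else 1 / 2) =
      (1 / 2 : ℝ) • (1 + Matrix.replicateCol Unit (fun _ : σ => (1 : ℝ)) *
        Matrix.replicateRow Unit (fun _ : σ => (1 : ℝ))) := by
    ext a b
    by_cases h : a = b
    · subst h; simp [Matrix.mul_apply]; norm_num
    · simp [Matrix.mul_apply, h]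
  rw [h, Matrix.det_smul, Matrix.det_one_add_replicateCol_mul_replicateRow]
  simp [dotProduct]
  ring

theorem exists_det_near {σ : Type*} [Fintype σ] [DecidableEq σ] (C : σ → σ → ℝ) {η : ℝ} (hη : 0 < η) :
    ∃ δ > 0, ∀ K : σ → σ → ℝ, (∀ a b, |K a b - C a b| ≤ δ) →
      |(Matrix.of K).det - (Matrix.of C).det| ≤ η := by
  have hc : Continuous fun K : σ → σ → ℝ => (Matrix.of K).det :=
    Continuous.matrix_det (A := fun K : σ → σ → ℝ => Matrix.of K) continuous_id
  obtain ⟨δ, hδ, h⟩ := Metric.continuous_iff.1 hc C η hη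
  refine ⟨δ / 2, by positivity, fun K hK => ?_⟩
  have := h K (lt_of_le_of_lt ((dist_pi_le_iff (by positivity)).2 fun a =>
    (dist_pi_le_iff (by positivity)).2 fun b => hK a b) (half_lt_self hδ))
  rw [Real.dist_eq] at this
  exact this.le

variable {V E : Type*} [Fintype V] [Fintype E] {G : MGraph V E}

/-- Left multiplication by `H`, with Green rows on the range of `g` and unit rows elsewhere, turns
the rows of `M` on that range into unit rows, that is, makes these vertices roots. `H` is block
triangular, with the Green minor as its only nontrivial diagonal block. -/
theorem Connected.forestCount_eq_det (hG : G.Connected) (v : V) {σ : Type*} [Fintype σ]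
    [DecidableEq σ] {g : σ → V} (hg : Function.Injective g) :
    (G.forestCount (insert v (Finset.univ.image g)) : ℝ) =
      G.forestCount {v} * (Matrix.of fun a b => G.green v (g a) (g b)).det := by
  set M := G.rootedLaplacian Finset.univ {v} with hM
  set H : Matrix V V ℝ := Matrix.of fun z w =>
    if z ∈ Set.range g then G.green v z w else (1 : Matrix V V ℝ) z w with hH
  have h1 : G.rootedLaplacian Finset.univ (insert v (Finset.univ.image g)) = H * M := by
    ext z w
    have hz : (H * M) z w = if z ∈ Set.range g then (1 : Matrix V V ℝ) z w else M z w := by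
      by_cases hz : z ∈ Set.range g
      · rw [if_pos hz, ← Matrix.nonsing_inv_mul _ (hG.isUnit_det v), Matrix.mul_apply,
          Matrix.mul_apply]
        simp only [hH, Matrix.of_apply, if_pos hz]
        rfl
      · rw [if_neg hz, ← Matrix.one_mul M, Matrix.mul_apply, Matrix.mul_apply]
        simp only [hH, Matrix.of_apply, if_neg hz, Matrix.one_mul]
    rw [hz]
    by_cases hz : z ∈ Set.range g
    · obtain ⟨a, rfl⟩ := hz
      simp [rootedLaplacian, Matrix.one_apply]
    · have hz' : ∀ a, g a ≠ z := fun a h => hz ⟨a, h⟩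
      rw [if_neg hz]
      simp [rootedLaplacian, hM, hz']
  rw [← det_rootedLaplacian_univ, ← det_rootedLaplacian_univ, h1, Matrix.det_mul, mul_comm]
  congr 1
  rw [Matrix.twoBlockTriangular_det H (fun z => z ∈ Set.range g)]
  · have h2 : (H.toSquareBlockProp fun z => ¬ z ∈ Set.range g) = 1 := by
      ext z w
      have := z.2
      simp only [Set.mem_range] at this
      simp [Matrix.toSquareBlockProp_def, hH, Matrix.one_apply, Subtype.ext_iff, this]
    rw [h2, Matrix.det_one, mul_one]
    let e : σ ≃ {z // z ∈ Set.range g} := Equiv.ofInjective g hg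
    have h3 := Matrix.det_submatrix_equiv_self e (H.toSquareBlockProp fun z => z ∈ Set.range g)
    trans ((H.toSquareBlockProp fun z => z ∈ Set.range g).submatrix e e).det
    · convert h3.symm
    congr 1
    ext a b
    have : (e a : V) ∈ Set.range g := (e a).2
    rw [Matrix.submatrix_apply, Matrix.toSquareBlockProp_def, Matrix.of_apply, Matrix.of_apply, hH,
      Matrix.of_apply, if_pos this]
    rfl
  · intro z hz w hw
    simp only [hH, Matrix.of_apply, if_neg hz]
    rw [Matrix.one_apply_ne]
    rintro rfl
    exact hz hw

end Determinants

end MGraph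

namespace MGraph

/-! ### Weighted count of injective maps -/

section Embeddings

open Classical

variable {τ V : Type*} [Fintype τ] [Fintype V]

/-- The injective maps that agree with `g` on `U`. -/
noncomputable def injExtensions (U : Finset τ) (g : τ → V) : Finset (τ → V) :=
  {f | Function.Injective f ∧ ∀ a ∈ U, f a = g a}

theorem sum_injExtensions (U : Finset τ) (g : τ → V) {y : τ} (hy : y ∉ U)
    (F : (τ → V) → ℝ) :
    ∑ f ∈ injExtensions U g, F f =
      ∑ w ∈ (U.image g)ᶜ, ∑ f ∈ injExtensions (insert y U) (Function.update g y w), F f := by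
  rw [← Finset.sum_fiberwise_of_maps_to (s := injExtensions U g) (t := (U.image g)ᶜ)
    (g := fun f => f y)]
  · refine Finset.sum_congr rfl fun w _ => Finset.sum_congr ?_ fun _ _ => rfl
    ext f
    simp only [injExtensions, Finset.mem_filter, Finset.mem_univ, true_and, Finset.mem_insert,
      forall_eq_or_imp, Function.update_self]
    have : (∀ a ∈ U, f a = Function.update g y w a) ↔ ∀ a ∈ U, f a = g a := by
      refine forall₂_congr fun a ha => ?_
      rw [Function.update_of_ne (by rintro rfl; exact hy ha)]
    rw [this]
    tauto
  · intro f hf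
    simp only [injExtensions, Finset.mem_filter, Finset.mem_univ, true_and] at hf
    rw [Finset.mem_compl, Finset.mem_image]
    rintro ⟨a, ha, h⟩
    rw [← hf.2 a ha] at h
    exact hy (hf.1 h ▸ ha)

/-- Each new vertex contributes a factor equal to the total weight out of `g p`, which is within `δ`
of 1, minus the weight of occupied vertices. These number at most `Fintype.card τ`, each of weight
at most `δ`, hence the factor `Fintype.card τ + 1`. -/
theorem sum_prod_injExtensions_near {ω : V → V → ℝ} {δ : ℝ} (hω : ∀ a b, 0 ≤ ω a b) (hδ : 0 ≤ δ)
    (hδ' : (Fintype.card τ + 1) * δ ≤ 1)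
    (hsum : ∀ a, |∑ w ∈ Finset.univ.erase a, ω a w - 1| ≤ δ) (hle : ∀ a b, a ≠ b → ω a b ≤ δ)
    {U : Finset τ} {L : List (τ × τ)} (hL : Grows U L) (g : τ → V) (hg : Set.InjOn g U) :
    (1 - (Fintype.card τ + 1) * δ) ^ L.length ≤
        ∑ f ∈ injExtensions U g, (L.map fun q => ω (f q.1) (f q.2)).prod ∧
      ∑ f ∈ injExtensions U g, (L.map fun q => ω (f q.1) (f q.2)).prod ≤ (1 + δ) ^ L.length := by
  induction hL generalizing g with
  | nil =>
    have : injExtensions Finset.univ g = {g} := by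
      ext f
      simp only [injExtensions, Finset.mem_filter, Finset.mem_univ, true_and, forall_const,
        Finset.mem_singleton, ← funext_iff]
      constructor
      · exact fun h => h.2
      · rintro rfl
        exact ⟨Set.injOn_univ.1 (by simpa using hg), rfl⟩
    simp [this]
  | @cons U p y L hp hy h ih =>
    set m : ℝ := (Fintype.card τ : ℝ) + 1
    set F : (τ → V) → ℝ := fun f => (L.map fun q => ω (f q.1) (f q.2)).prod
    have hF : ∑ f ∈ injExtensions U g, (((p, y) :: L).map fun q => ω (f q.1) (f q.2)).prod =
        ∑ w ∈ (U.image g)ᶜ, ω (g p) w *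
          ∑ f ∈ injExtensions (insert y U) (Function.update g y w), F f := by
      rw [sum_injExtensions U g hy]
      refine Finset.sum_congr rfl fun w _ => ?_
      rw [Finset.mul_sum]
      refine Finset.sum_congr rfl fun f hf => ?_
      simp only [injExtensions, Finset.mem_filter, Finset.mem_univ, true_and] at hf
      have h1 := hf.2 y (Finset.mem_insert_self _ _)
      have h2 := hf.2 p (Finset.mem_insert_of_mem hp)
      rw [Function.update_self] at h1
      rw [Function.update_of_ne (by rintro rfl; exact hy hp)] at h2
      simp [F, h1, h2]
    have hih : ∀ w ∈ (U.image g)ᶜ, (1 - m * δ) ^ L.length ≤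
        ∑ f ∈ injExtensions (insert y U) (Function.update g y w), F f ∧
        ∑ f ∈ injExtensions (insert y U) (Function.update g y w), F f ≤ (1 + δ) ^ L.length := by
      intro w hw
      apply ih
      rw [Finset.mem_compl] at hw
      have heq : Set.EqOn (Function.update g y w) g U := fun a ha =>
        Function.update_of_ne (by rintro rfl; exact hy ha) _ _
      rw [Finset.coe_insert, Set.injOn_insert (by simpa using hy)]
      refine ⟨hg.congr heq.symm, ?_⟩
      rw [Function.update_self, heq.image_eq]
      simpa using hw
    have hsub : (U.image g)ᶜ ⊆ Finset.univ.erase (g p) := by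
      intro w hw
      rw [Finset.mem_compl] at hw
      rw [Finset.mem_erase]
      refine ⟨?_, Finset.mem_univ _⟩
      rintro rfl
      exact hw (Finset.mem_image_of_mem g hp)
    have hs := abs_le.1 (hsum (g p))
    have hup : ∑ w ∈ (U.image g)ᶜ, ω (g p) w ≤ 1 + δ :=
      (Finset.sum_le_sum_of_subset_of_nonneg hsub fun _ _ _ => hω _ _).trans (by linarith)
    have hlow : 1 - m * δ ≤ ∑ w ∈ (U.image g)ᶜ, ω (g p) w := by
      have h1 := Finset.sum_sdiff (f := fun w => ω (g p) w) hsub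
      have h2 : ∑ w ∈ Finset.univ.erase (g p) \ (U.image g)ᶜ, ω (g p) w ≤
          (Fintype.card τ : ℝ) * δ := by
        calc _ ≤ ∑ w ∈ Finset.univ.erase (g p) \ (U.image g)ᶜ, δ :=
              Finset.sum_le_sum fun w hw => hle _ _ (by
                have := Finset.ne_of_mem_erase (Finset.mem_sdiff.1 hw).1
                exact this.symm)
          _ = ((Finset.univ.erase (g p) \ (U.image g)ᶜ).card : ℝ) * δ := by simp
          _ ≤ _ := by
              apply mul_le_mul_of_nonneg_right _ hδ
              have : Finset.univ.erase (g p) \ (U.image g)ᶜ ⊆ U.image g := by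
                intro w hw
                simpa using (Finset.mem_sdiff.1 hw).2
              exact_mod_cast (Finset.card_le_card this).trans
                (Finset.card_image_le.trans (Finset.card_le_univ _))
      have h3 : m * δ = Fintype.card τ * δ + δ := by simp only [m]; ring
      linarith
    rw [hF, List.length_cons, pow_succ', pow_succ']
    constructor
    · calc _ ≤ (∑ w ∈ (U.image g)ᶜ, ω (g p) w) * (1 - m * δ) ^ L.length :=
            mul_le_mul_of_nonneg_right hlow (pow_nonneg (by linarith) _)
        _ ≤ _ := by
            rw [Finset.sum_mul]
            exact Finset.sum_le_sum fun w hw =>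
              mul_le_mul_of_nonneg_left (hih w hw).1 (hω _ _)
    · calc _ ≤ (∑ w ∈ (U.image g)ᶜ, ω (g p) w) * (1 + δ) ^ L.length := by
            rw [Finset.sum_mul]
            exact Finset.sum_le_sum fun w hw =>
              mul_le_mul_of_nonneg_left (hih w hw).2 (hω _ _)
        _ ≤ _ := mul_le_mul_of_nonneg_right hup (by positivity)

end Embeddings

/-! ### The expectation formula and its limit -/

section Main

open Classical

variable {V E τ : Type*} [Fintype V] [Fintype E] [Fintype τ]

/-- Viewed as a multigraph whose edges are unordered pairs, `t` is its own spanning tree, so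
`exists_grows` orders its edges. -/
theorem exists_grows_of_isTree {t : SimpleGraph τ} (ht : t.IsTree) (x : τ) :
    ∃ L, Grows {x} L ∧ ∀ a b, t.Adj a b ↔ ∃ q ∈ L, s(a, b) = s(q.1, q.2) := by
  let T : MGraph τ (Sym2 τ) := ⟨id⟩
  have hT : T.nbrGraph (t.edgeFinset : Set (Sym2 τ)) = t := by
    simp [nbrGraph, T]
  have h : T.IsSpanningTree t.edgeFinset := by
    refine ⟨fun e he => SimpleGraph.not_isDiag_of_mem_edgeFinset he, ?_, by rwa [hT]⟩
    exact Function.injective_id.injOn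
  obtain ⟨L, hL, hq⟩ := ((isSpanningTree_iff_isRootedForest x).1 h).exists_grows
  refine ⟨L, hL, fun a b => ?_⟩
  rw [← hq]
  simp [T]

theorem ustExpectation_treeMapCount (G : MGraph V E) (v : V) {t : SimpleGraph τ} {x : τ}
    {L : List (τ × τ)} (hL : Grows {x} L)
    (hadj : ∀ a b, t.Adj a b ↔ ∃ q ∈ L, s(a, b) = s(q.1, q.2)) :
    (G.ustExpectation fun T => (treeMapCount t x (G.nbrGraph (T : Set E)) v : ℝ)) =
      ∑ f ∈ injExtensions {x} (fun _ => v),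
        (L.map fun q => (G.edgeCount Finset.univ (f q.1) (f q.2) : ℝ)).prod *
          (G.forestCount (Finset.univ.image f) / G.spanningTrees.card) := by
  have h1 : ∀ T : Finset E, (treeMapCount t x (G.nbrGraph (T : Set E)) v : ℝ) =
      ∑ f ∈ injExtensions {x} (fun _ => v),
        if ∀ a b, t.Adj a b → (G.nbrGraph (T : Set E)).Adj (f a) (f b) then 1 else 0 := by
    intro T
    rw [treeMapCount, Nat.card_eq_fintype_card, Fintype.card_subtype, ← Finset.sum_filter,
      Finset.sum_const, nsmul_eq_mul, mul_one]
    congr 2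
    ext f
    simp [injExtensions, and_assoc]
  have h2 : (G.ustExpectation fun T => (treeMapCount t x (G.nbrGraph (T : Set E)) v : ℝ)) =
      ∑ f ∈ injExtensions {x} (fun _ => v), ∑ T : Finset E,
        if (G.IsSpanningTree T ∧
          ∀ a b, t.Adj a b → (G.nbrGraph (T : Set E)).Adj (f a) (f b)) then
            1 / (G.spanningTrees.card : ℝ) else 0 := by
    unfold ustExpectation
    rw [Finset.sum_comm]
    refine Finset.sum_congr rfl fun T _ => ?_
    simp only [h1]
    rw [Finset.mul_sum]
    refine Finset.sum_congr rfl fun f _ => ?_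
    have : T ∈ G.spanningTrees ↔ G.IsSpanningTree T := by simp [spanningTrees]
    simp only [ustProb, this]
    by_cases ha : G.IsSpanningTree T <;>
      by_cases hb : ∀ a b, t.Adj a b → (G.nbrGraph (T : Set E)).Adj (f a) (f b) <;>
      simp [ha, hb]
  rw [h2]
  refine Finset.sum_congr rfl fun f hf => ?_
  simp only [injExtensions, Finset.mem_filter, Finset.mem_univ, true_and,
    Finset.mem_singleton, forall_eq] at hf
  obtain ⟨hf, hfx⟩ := hf
  have h3 := G.card_forestsThrough_map hf hL
  rw [Finset.image_singleton, hfx] at h3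
  rw [← Finset.sum_filter, Finset.sum_const, nsmul_eq_mul]
  have h4 : (Finset.univ.filter fun T : Finset E => G.IsSpanningTree T ∧
      ∀ a b, t.Adj a b → (G.nbrGraph (T : Set E)).Adj (f a) (f b)) =
      G.forestsThrough {v} (L.map (Prod.map f f)) := by
    ext T
    simp only [forestsThrough, Finset.mem_filter, Finset.mem_univ, true_and,
      isSpanningTree_iff_isRootedForest v]
    refine and_congr_right fun _ => ?_
    constructor
    · intro h q hq
      obtain ⟨r, hr, rfl⟩ := List.mem_map.1 hq
      exact (nbrGraph_adj.1 (h r.1 r.2 ((hadj _ _).2 ⟨r, hr, rfl⟩))).1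
    · intro h a b hab
      obtain ⟨q, hq, he⟩ := (hadj a b).1 hab
      obtain ⟨e, heT, hends⟩ := h _ (List.mem_map_of_mem hq)
      refine nbrGraph_adj.2 ⟨⟨e, heT, ?_⟩, fun h' => hab.ne (hf h')⟩
      rw [hends]
      exact (congrArg (Sym2.map f) he).symm
  rw [h4, h3]
  push_cast
  rw [List.map_map]
  simp only [Function.comp_def]
  ring

theorem Connected.forestCount_image_div {G : MGraph V E} (hG : G.Connected) (v : V) {x : τ}
    {f : τ → V} (hf : Function.Injective f) (hfx : f x = v) {r : ℝ} (hr : r ≠ 0) :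
    (G.forestCount (Finset.univ.image f) : ℝ) / G.spanningTrees.card =
      r ^ Fintype.card {a // a ≠ x} *
        (Matrix.of fun a b : {a // a ≠ x} => G.green v (f a) (f b) / r).det := by
  have h1 : Finset.univ.image f =
      insert v (Finset.univ.image fun a : {a // a ≠ x} => f a) := by
    ext w
    simp only [Finset.mem_image, Finset.mem_univ, true_and, Finset.mem_insert]
    constructor
    · rintro ⟨a, rfl⟩
      by_cases ha : a = x
      · exact .inl (by rw [ha, hfx])
      · exact .inr ⟨⟨a, ha⟩, rfl⟩
    · rintro (rfl | ⟨a, rfl⟩)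
      · exact ⟨x, hfx⟩
      · exact ⟨a, rfl⟩
  rw [h1, hG.forestCount_eq_det v (g := fun a : {a // a ≠ x} => f a)
    (hf.comp Subtype.val_injective), forestCount_singleton]
  have h2 : (G.spanningTrees.card : ℝ) ≠ 0 := by
    rw [← G.forestCount_singleton v]
    exact_mod_cast (hG.forestCount_pos (by simp)).ne'
  rw [mul_div_cancel_left₀ _ h2, ← Matrix.det_smul]
  congr 1
  ext a b
  simp only [Matrix.of_apply, Matrix.smul_apply, smul_eq_mul]
  field_simp

theorem exists_ustExpectation_near.{u, w} {t : SimpleGraph τ} (ht : t.IsTree) (x : τ) {η : ℝ}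
    (hη : 0 < η) :
    ∃ ε > 0, ∃ N : ℝ, ∀ (V : Type u) (E : Type w) [Fintype V] [Fintype E] (G : MGraph V E),
      G.Connected → N ≤ Fintype.card V →
      (∀ x y z : V, x ≠ y → x ≠ z → y ≠ z → |G.hitBeforeProb x y z - 1 / 2| ≤ ε) →
      ∀ v, |(G.ustExpectation fun T => (treeMapCount t x (G.nbrGraph (T : Set E)) v : ℝ)) -
        Fintype.card τ| ≤ η := by
  obtain ⟨L, hL, hadj⟩ := exists_grows_of_isTree ht x
  set m : ℝ := (Fintype.card τ : ℝ) with hm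
  set k := Fintype.card {a // a ≠ x} with hk
  have hLk : L.length + 1 = Fintype.card τ := by simpa using hL.length_add_card
  have hkL : k = L.length := by
    have : k = Fintype.card τ - 1 := Set.card_ne_eq x
    omega
  have hm0 : 0 ≤ m := by positivity
  -- The final error is `(m + 2) * θ`; `θ ≤ 1` keeps the total weight `S` at most 2.
  set θ : ℝ := min 1 (η / (m + 2)) with hθ
  have hθ0 : 0 < θ := lt_min one_pos (by positivity)
  obtain ⟨δ₁, hδ₁, hdet⟩ := exists_det_near
    (fun a b : {a // a ≠ x} => if a = b then (1 : ℝ) else 1 / 2)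
    (η := θ / 2 ^ k) (by positivity)
  obtain ⟨δ, hδ, hδδ₁, hδm, hlow, hup, hδ3⟩ : ∃ δ : ℝ, 0 < δ ∧ δ ≤ δ₁ ∧ (m + 1) * δ ≤ 1 ∧
      1 - θ ≤ (1 - (m + 1) * δ) ^ L.length ∧ (1 + δ) ^ L.length ≤ 1 + θ ∧ δ ≤ 3 / 10 := by
    have c1 : Tendsto (fun δ : ℝ => (m + 1) * δ) (𝓝[>] 0) (𝓝 0) := by
      have : ContinuousAt (fun δ : ℝ => (m + 1) * δ) 0 := by fun_prop
      simpa [ContinuousAt] using this.mono_left nhdsWithin_le_nhds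
    have c2 : Tendsto (fun δ : ℝ => (1 - (m + 1) * δ) ^ L.length) (𝓝[>] 0) (𝓝 1) := by
      simpa using ((tendsto_const_nhds (x := (1 : ℝ))).sub c1).pow L.length
    have c3 : Tendsto (fun δ : ℝ => δ) (𝓝[>] 0) (𝓝 0) := nhdsWithin_le_nhds
    have c4 : Tendsto (fun δ : ℝ => (1 + δ) ^ L.length) (𝓝[>] 0) (𝓝 1) := by
      simpa using ((tendsto_const_nhds (x := (1 : ℝ))).add c3).pow L.length
    have c5 : ∀ᶠ δ : ℝ in 𝓝[>] 0, 0 < δ := self_mem_nhdsWithin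
    have := c5.and ((c3.eventually_le_const hδ₁).and
      ((c1.eventually_le_const one_pos).and
      ((c2.eventually_const_le (show 1 - θ < 1 by linarith)).and
      ((c4.eventually_le_const (show 1 < 1 + θ by linarith)).and
      (c3.eventually_le_const (show (0 : ℝ) < 3 / 10 by norm_num))))))
    exact this.exists
  -- The estimates lose a factor 30, so they hold with error `δ`. The size bound provides some `u ≠
  -- v` and the pigeonhole step in `degree_near`.
  refine ⟨δ / 30, by positivity, max 2 (1 / (δ / 30) + 1), ?_⟩
  intro V E _ _ G hG hN hhit v
  have hε : 0 < δ / 30 := by positivity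
  have hε' : δ / 30 ≤ 1 / 100 := by linarith
  have h30 : 30 * (δ / 30) = δ := by ring
  have hN2 : 1 < Fintype.card V := by
    have : (2 : ℝ) ≤ Fintype.card V := (le_max_left _ _).trans hN
    exact_mod_cast this
  obtain ⟨u, huv⟩ := Fintype.exists_ne_of_one_lt_card hN2 v
  set r := G.green v u u with hr
  have pr : 0 < r := hG.green_diag_pos u v
  set ω : V → V → ℝ := fun a b => G.edgeCount Finset.univ a b * r / 2 with hω
  have hdeg := hG.degree_near hε hε' ((le_max_right _ _).trans hN) hhit huv
  rw [h30] at hdeg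
  obtain ⟨s1, s2⟩ := sum_prod_injExtensions_near (ω := ω) (fun a b => by positivity) hδ.le hδm
    (fun a => by
      have := (hdeg a).1
      rwa [properDegree, mul_div_assoc, Finset.sum_mul, ← Finset.sum_congr rfl fun _ _ =>
        mul_div_assoc _ _ _] at this)
    (fun a b hab => (hdeg a).2 b hab) hL (fun _ => v) (by simp)
  set D : (τ → V) → ℝ := fun f =>
    (Matrix.of fun a b : {a // a ≠ x} => G.green v (f a) (f b) / r).det with hD
  set P : (τ → V) → ℝ := fun f => (L.map fun q => ω (f q.1) (f q.2)).prod with hP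
  have hP0 : ∀ f, 0 ≤ P f := fun f => List.prod_nonneg (by
    intro a ha
    obtain ⟨q, -, rfl⟩ := List.mem_map.1 ha
    simp only [hω]
    positivity)
  -- Writing `r ^ k = 2 ^ k * (r / 2) ^ k` gives each of the `k` edges of `t` its factor `r / 2`.
  have hE : (G.ustExpectation fun T => (treeMapCount t x (G.nbrGraph (T : Set E)) v : ℝ)) =
      ∑ f ∈ injExtensions {x} (fun _ => v), P f * (2 ^ k * D f) := by
    rw [ustExpectation_treeMapCount G v hL hadj]
    refine Finset.sum_congr rfl fun f hf => ?_
    simp only [injExtensions, Finset.mem_filter, Finset.mem_univ, true_and,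
      Finset.mem_singleton, forall_eq] at hf
    rw [hG.forestCount_image_div v hf.1 hf.2 pr.ne']
    have : P f = (L.map fun q => (G.edgeCount Finset.univ (f q.1) (f q.2) : ℝ)).prod *
        (r / 2) ^ k := by
      rw [hkL]
      simp only [hP, hω, mul_div_assoc]
      rw [List.prod_map_mul]
      simp
    rw [this, div_pow]
    simp only [hD, ← hk]
    field_simp
  have hDf : ∀ f ∈ injExtensions {x} (fun _ => v), |2 ^ k * D f - m| ≤ θ := by
    intro f hf
    simp only [injExtensions, Finset.mem_filter, Finset.mem_univ, true_and,
      Finset.mem_singleton, forall_eq] at hf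
    have hne : ∀ a : {a // a ≠ x}, f a ≠ v := fun a h => a.2 (hf.1 (h.trans hf.2.symm))
    have h1 := hdet (fun a b => G.green v (f a) (f b) / r) (fun a b => by
      have := hG.green_near hε.le hε' hhit huv (hne a) (hne b)
      rw [h30, ← hr] at this
      have hab : f a = f b ↔ a = b := by rw [hf.1.eq_iff, Subtype.ext_iff]
      simp only [hab] at this
      exact this.trans hδδ₁)
    rw [det_one_half_matrix, le_div_iff₀ (by positivity), ← hk] at h1
    have h2 : 2 ^ k * D f - m = (D f - (k + 1) / 2 ^ k) * 2 ^ k := by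
      have : m = k + 1 := by
        rw [hm, ← hLk, hkL]; push_cast; ring
      rw [this]
      field_simp
    rw [h2, abs_mul, abs_of_pos (show (0 : ℝ) < 2 ^ k by positivity)]
    exact h1
  have hS : |∑ f ∈ injExtensions {x} (fun _ => v), P f - 1| ≤ θ :=
    abs_le.2 ⟨by linarith, by linarith⟩
  set S := ∑ f ∈ injExtensions {x} (fun _ => v), P f with hSdef
  -- The two errors are separated: the determinant's deviation from its limit, averaged with weights
  -- `P`, and the deviation of the total weight from 1.
  have hdiff : ∑ f ∈ injExtensions {x} (fun _ => v), P f * (2 ^ k * D f) - m =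
      ∑ f ∈ injExtensions {x} (fun _ => v), P f * (2 ^ k * D f - m) + (S - 1) * m := by
    simp only [mul_sub, Finset.sum_sub_distrib, ← Finset.sum_mul, ← hSdef]
    ring
  rw [hE, hdiff]
  calc _ ≤ |∑ f ∈ injExtensions {x} (fun _ => v), P f * (2 ^ k * D f - m)| + |(S - 1) * m| :=
        abs_add_le _ _
    _ ≤ ∑ f ∈ injExtensions {x} (fun _ => v), P f * θ + θ * m := by
        gcongr
        · refine (Finset.abs_sum_le_sum_abs _ _).trans (Finset.sum_le_sum fun f hf => ?_)
          rw [abs_mul, abs_of_nonneg (hP0 f)]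
          exact mul_le_mul_of_nonneg_left (hDf f hf) (hP0 f)
        · rw [abs_mul, abs_of_nonneg hm0]
          exact mul_le_mul_of_nonneg_right hS hm0
    _ = S * θ + θ * m := by rw [← Finset.sum_mul]
    _ ≤ 2 * θ + θ * m := by
        have : S ≤ 2 := by
          have := (abs_le.1 hS).2
          have : θ ≤ 1 := min_le_left _ _
          linarith
        gcongr
    _ = (m + 2) * θ := by ring
    _ ≤ (m + 2) * (η / (m + 2)) :=
        mul_le_mul_of_nonneg_left (min_le_right _ _) (by positivity)
    _ = η := by field_simp

end Main

end MGraph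

theorem mainTheorem6 {V E : ℕ → Type*} [∀ n, Fintype (V n)] [∀ n, Fintype (E n)]
    (G : ∀ n, MGraph (V n) (E n)) (hconn : ∀ n, (G n).Connected)
    (hG : MGraph.GinoRegular G) (v : ∀ n, V n)
    {τ : Type*} [Fintype τ] (t : SimpleGraph τ) (ht : t.IsTree) (x : τ) :
    Tendsto
      (fun n => (G n).ustExpectation fun T =>
        (treeMapCount t x ((G n).nbrGraph (T : Set (E n))) (v n) : ℝ))
      atTop (𝓝 (Fintype.card τ : ℝ)) := by
  obtain ⟨hcard, D, -, hhit⟩ := hG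
  rw [Metric.tendsto_atTop']
  intro η hη
  obtain ⟨ε, hε, N, h⟩ := MGraph.exists_ustExpectation_near ht x (half_pos hη)
  have h1 : ∀ᶠ n in atTop, N ≤ (Fintype.card (V n) : ℝ) :=
    (tendsto_natCast_atTop_atTop.comp hcard).eventually_ge_atTop N
  obtain ⟨n₀, hn₀⟩ := eventually_atTop.1 (h1.and (hhit ε hε))
  refine ⟨n₀, fun n hn => ?_⟩
  rw [Real.dist_eq]
  exact (h (V n) (E n) (G n) (hconn n) (hn₀ n hn.le).1 (hn₀ n hn.le).2 (v n)).trans_lt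
    (half_lt_self hη)
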